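/- Let $\ell\ge 1$ be an integer, let $0<p<q=1-p$ and $\rho=p/q$. Let $U$ and $V$ be the infinite matrices indexed by $\{0,1,2,\dots\}$ with $U_{n,n}=q$, $U_{n,n+1}=p$ for all $n\ge 0$; $V_{0,0}=1$ and $V_{n,n-1}=q$, $V_{n,n}=p$ for $n\ge 1$; all other entries are $0$. Put $P_\ell=U^\ell V^\ell$ (the transition matrix of the length of the line at a traffic light observed at the beginning of each red period of length $\ell$, which is followed by a green period of length $\ell$). Let $p_j=\binom{2\ell}{\ell+j}p^{\ell+j}q^{\ell-j}$ for $-\ell\le j\le \ell$ and $p_j=0$ otherwise, and for $k=-1,0,1$ let $A_k$ be the $\ell\times\ell$ matrix with entries $(A_k)_{ij}=p_{k\ell+j-i}$. For $1\le j\le \ell$ let $\sigma_j,\mu_j\in\mathbb C$, $|\sigma_j|\le|\mu_j|$, be the two roots of $(pz+q)^2-\omega_\ell^{\,j-1}z$, where $\omega_\ell=\cos(2\pi/\ell)+\mathbf i\sin(2\pi/\ell)$. There is exactly one nonnegative matrix $R$ with all its eigenvalues in the open unit disk such that $R^2A_{-1}+R(A_0-I)+A_1=0$, and $P_\ell$ has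 exactly one stationary probability vector $(\pi_n)_{n\ge0}$. The boundary vector $\boldsymbol\pi_0^T=(\pi_0,\pi_1,\dots,\pi_{\ell-1})$ is given by $$\boldsymbol\pi_0^T=c\,\mathbf e_1^T R,\qquad c=-\prod_{\nu=1}^{\ell}(1-\mu_\nu),\qquad \mathbf e_1^T=(1,0,\dots,0).$$ Consequently, as $n\to\infty$, $$\pi_n\sim c(\ell,p)\,\rho^{2n},\qquad c(\ell,p)=(\mu_1-1)\,\mu_1^{-1}\prod_{\nu=2}^{\ell}(1-\mu_\nu)(\mu_1-\mu_\nu)^{-1}.$$ -/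

import Mathlib

noncomputable section

namespace TrafficLight

/-- Product of two infinite matrices indexed by `ℕ`.  It is only applied below to
nonnegative matrices whose rows have finite support, so every sum has finitely many
nonzero terms. -/
def infMul (M N : ℕ → ℕ → ℝ) : ℕ → ℕ → ℝ := fun i j => ∑' k, M i k * N k j

/-- Powers of an infinite matrix. -/
def infPow (M : ℕ → ℕ → ℝ) : ℕ → ℕ → ℕ → ℝ
  | 0 => fun i j => if i = j then 1 else 0
  | n + 1 => infMul (infPow M n) M

/-- One time step under a red light: the line grows by one with probability `p`
and stays the same with probability `1 - p`. -/
def redStep (p : ℝ) : ℕ → ℕ → ℝ := fun i j =>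
  if j = i then 1 - p else if j = i + 1 then p else 0

/-- One time step under a green light: an empty line stays empty; a nonempty line stays the
same with probability `p` and shrinks by one with probability `1 - p`. -/
def greenStep (p : ℝ) : ℕ → ℕ → ℝ := fun i j =>
  if i = 0 then (if j = 0 then 1 else 0)
  else if j = i then p else if j + 1 = i then 1 - p else 0

/-- The transition matrix `P_ℓ = U ^ ℓ V ^ ℓ` of the line length observed at the beginning of
each red period. -/
def cycleMatrix (ℓ : ℕ) (p : ℝ) : ℕ → ℕ → ℝ :=
  infMul (infPow (redStep p) ℓ) (infPow (greenStep p) ℓ)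

/-- `π` is a stationary probability vector of the infinite matrix `P`. -/
structure IsStationary (P : ℕ → ℕ → ℝ) (π : ℕ → ℝ) : Prop where
  nonneg : ∀ n, 0 ≤ π n
  hasSum_one : HasSum π 1
  invariant : ∀ j, HasSum (fun i => π i * P i j) (π j)

/-- `p_j = (2ℓ choose ℓ+j) p^(ℓ+j) (1-p)^(ℓ-j)` for `-ℓ ≤ j ≤ ℓ`, and `0` for other `j`. -/
def jumpProb (ℓ : ℕ) (p : ℝ) (j : ℤ) : ℝ :=
  if -(ℓ : ℤ) ≤ j ∧ j ≤ (ℓ : ℤ) then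
    ((2 * ℓ).choose ((ℓ : ℤ) + j).toNat : ℝ) * p ^ ((ℓ : ℤ) + j).toNat
      * (1 - p) ^ ((ℓ : ℤ) - j).toNat
  else 0

/-- The `ℓ × ℓ` Toeplitz block `A_k`, with entries `p_{kℓ + j - i}`; it is used for
`k = -1, 0, 1`. -/
def block (ℓ : ℕ) (p : ℝ) (k : ℤ) : Matrix (Fin ℓ) (Fin ℓ) ℝ :=
  Matrix.of fun i j => jumpProb ℓ p (k * (ℓ : ℤ) + (j : ℕ) - (i : ℕ))

/-- `R` is a nonnegative solution of `R² A_{-1} + R (A_0 - I) + A_1 = 0`, all of whose (complex)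
eigenvalues lie in the open unit disk. -/
structure IsRateMatrix (ℓ : ℕ) (p : ℝ) (R : Matrix (Fin ℓ) (Fin ℓ) ℝ) : Prop where
  nonneg : ∀ i j, 0 ≤ R i j
  equation : R ^ 2 * block ℓ p (-1) + R * (block ℓ p 0 - 1) + block ℓ p 1 = 0
  spectrum_lt_one : ∀ z ∈ spectrum ℂ (R.map Complex.ofReal), ‖z‖ < 1

/-- The root of unity `ω_ℓ = cos (2π/ℓ) + i sin (2π/ℓ)`. -/
def rootOfUnity (ℓ : ℕ) : ℂ :=
  (Real.cos (2 * Real.pi / ℓ) : ℂ) + (Real.sin (2 * Real.pi / ℓ) : ℂ) * Complex.I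

/-- For every `j`, the numbers `σ j` and `μ j` are the two roots (with multiplicity) of the
quadratic polynomial `(p z + 1 - p)² - ω_ℓ ^ j z`, labelled so that `|σ j| ≤ |μ j|`.  The index
`j` runs from `0` to `ℓ - 1`. -/
def AreRootPairs (ℓ : ℕ) (p : ℝ) (σ μ : Fin ℓ → ℂ) : Prop :=
  ∀ j : Fin ℓ,
    (∀ z : ℂ, ((p : ℂ) * z + (1 - (p : ℂ))) ^ 2 - rootOfUnity ℓ ^ (j : ℕ) * z
      = (p : ℂ) ^ 2 * ((z - σ j) * (z - μ j))) ∧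
    ‖σ j‖ ≤ ‖μ j‖

end TrafficLight

end

open Polynomial Filter Topology

namespace TrafficLight

/-! Away from column 0, `cycleMatrix` is a Toeplitz matrix of binomial jump probabilities. With `S`
the left shift and `q = 1 - p`, the balance equations become the constant-coefficient recurrence
`((p + qS)^(2ℓ) - S^ℓ) y = 0` (`FullRec`). Roots of unity factor its polynomial as `p^(2ℓ) ∏ (1 -
σ_j S)(1 - μ_j S)`, where `|σ_j| ≤ 1 < |μ_j|`. A null sequence killed by `1 - aS` with `|a| ≤ 1` is
zero, so every null solution satisfies `∏ (1 - μ_j S) y = 0` (`FullRec.reduced`) and is fixed by its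
first `ℓ` values.

Row `i` of `(I, R, R², …)` is such a solution, with initial values `e_i`; hence `R` is unique. It
exists as the limit of a monotone iteration controlled by the geometric vector of ratio `t =
(p/q)²`.

Let `x` be the row `i = 0`. Preceded by zeros, a stationary vector is also a null solution, and
comparing initial values makes `π n` proportional to `x (n + ℓ)`. Summing the recurrence for `x`
over all `n` gives the total mass `1 / c`, where `c = -∏ (1 - μ_j)`. Finally `μ₀ = (q/p)²` is the
unique `μ_j` of least modulus. Applying the other factors to `x` leaves exactly `μ₀⁻ⁿ`, which yields
the leading coefficient and a geometrically smaller error. -/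

/-! ### Linear recurrences as polynomials in the shift -/

/-- The left shift on complex sequences. -/
def shift : Module.End ℂ (ℕ → ℂ) := LinearMap.funLeft ℂ ℂ Nat.succ

lemma shift_pow_apply (k : ℕ) (y : ℕ → ℂ) (n : ℕ) : (shift ^ k) y n = y (n + k) := by
  induction k generalizing n with
  | zero => simp
  | succ k ih =>
    rw [pow_succ', Module.End.mul_apply]
    change (shift ^ k) y (n + 1) = _
    rw [ih]
    congr 1
    omega

lemma aeval_shift_apply {f : ℂ[X]} {N : ℕ} (hN : f.natDegree < N) (y : ℕ → ℂ) (n : ℕ) :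
    aeval shift f y n = ∑ k ∈ Finset.range N, f.coeff k * y (n + k) := by
  rw [aeval_eq_sum_range' hN]
  simp [LinearMap.sum_apply, Finset.sum_apply, shift_pow_apply]

lemma aeval_shift_monomial (a : ℂ) (m : ℕ) (y : ℕ → ℂ) (n : ℕ) :
    aeval shift (C a * X ^ m) y n = a * y (n + m) := by
  simp [shift_pow_apply, Module.algebraMap_end_apply]

lemma aeval_shift_factor (a : ℂ) (y : ℕ → ℂ) (n : ℕ) :
    aeval shift (1 - C a * X) y n = y n - a * y (n + 1) := by
  have := aeval_shift_monomial a 1 y n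
  rw [pow_one] at this
  rw [map_sub, LinearMap.sub_apply, Pi.sub_apply, this]
  simp

lemma aeval_shift_geometric (f : ℂ[X]) (r : ℂ) (n : ℕ) :
    aeval shift f (fun n => r ^ n) n = f.eval r * r ^ n := by
  rw [aeval_shift_apply (Nat.lt_succ_self _), eval_eq_sum_range, Finset.sum_mul]
  refine Finset.sum_congr rfl fun k _ => ?_
  ring

lemma tendsto_aeval_shift (f : ℂ[X]) {y : ℕ → ℂ} (hy : Tendsto y atTop (𝓝 0)) :
    Tendsto (aeval shift f y) atTop (𝓝 0) := by
  have h : aeval shift f y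
      = fun n => ∑ k ∈ Finset.range (f.natDegree + 1), f.coeff k * y (n + k) :=
    funext fun n => aeval_shift_apply (Nat.lt_succ_self _) y n
  rw [h]
  have : Tendsto (fun n => ∑ k ∈ Finset.range (f.natDegree + 1), f.coeff k * y (n + k)) atTop
      (𝓝 (∑ k ∈ Finset.range (f.natDegree + 1), f.coeff k * 0)) :=
    tendsto_finsetSum _ fun k _ => ((tendsto_add_atTop_iff_nat k).2 hy).const_mul _
  simpa using this

/-- A null sequence annihilated by `1 - a S` with `|a| ≤ 1` vanishes. -/
lemma eq_zero_of_factor {a : ℂ} (ha : ‖a‖ ≤ 1) {y : ℕ → ℂ} (hy : Tendsto y atTop (𝓝 0))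
    (h : aeval shift (1 - C a * X) y = 0) : y = 0 := by
  have hstep : ∀ n, ‖y n‖ ≤ ‖y (n + 1)‖ := fun n => by
    have := congrFun h n
    rw [aeval_shift_factor, Pi.zero_apply, sub_eq_zero] at this
    rw [this, norm_mul]
    exact mul_le_of_le_one_left (norm_nonneg _) ha
  funext n
  have : ‖y n‖ ≤ 0 :=
    (monotone_nat_of_le_succ hstep).ge_of_tendsto (by simpa using hy.norm) n
  simpa using this

lemma eq_zero_of_prod_factor {ι : Type*} (s : Finset ι) (a : ι → ℂ) (ha : ∀ i ∈ s, ‖a i‖ ≤ 1)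
    {y : ℕ → ℂ} (hy : Tendsto y atTop (𝓝 0))
    (h : aeval shift (∏ i ∈ s, (1 - C (a i) * X)) y = 0) : y = 0 := by
  classical
  induction s using Finset.induction_on generalizing y with
  | empty => simpa using h
  | insert i s hi ih =>
    rw [Finset.prod_insert hi, map_mul, Module.End.mul_apply] at h
    have h1 := eq_zero_of_factor (ha i (Finset.mem_insert_self i s)) (tendsto_aeval_shift _ hy) h
    exact ih (fun j hj => ha j (Finset.mem_insert_of_mem hj)) hy h1

/-- A solution of the recurrence with characteristic factors `1 - a i X` that vanishes initially
vanishes identically. -/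
lemma eq_zero_of_initial {ι : Type*} (s : Finset ι) (a : ι → ℂ) (ha : ∀ i ∈ s, a i ≠ 0)
    {y : ℕ → ℂ} (h : aeval shift (∏ i ∈ s, (1 - C (a i) * X)) y = 0)
    (h0 : ∀ k < s.card, y k = 0) : y = 0 := by
  classical
  induction s using Finset.induction_on generalizing y with
  | empty => simpa using h
  | insert i s hi ih =>
    rw [Finset.card_insert_of_notMem hi] at h0
    -- The single factor is made to act first: `(1 - a i S) y` has one initial zero fewer, matching
    -- the smaller set.
    rw [Finset.prod_insert hi, mul_comm, map_mul, Module.End.mul_apply] at h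
    have h1 := ih (fun j hj => ha j (Finset.mem_insert_of_mem hj)) h fun k hk => by
      rw [aeval_shift_factor, h0 k (by omega), h0 (k + 1) (by omega)]
      simp
    have hai := ha i (Finset.mem_insert_self i s)
    funext n
    induction n with
    | zero => exact h0 0 (by omega)
    | succ n hn =>
      have := congrFun h1 n
      rw [aeval_shift_factor, hn] at this
      simpa [hai] using this

/-- Solutions of the recurrence with characteristic factors `1 - a i X` are bounded by `τ ^ n`
as soon as `τ` exceeds all the `‖a i‖⁻¹`. -/
lemma exists_geometric_bound {ι : Type*} (s : Finset ι) (a : ι → ℂ) {τ : ℝ} (hτ : 0 < τ)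
    (ha : ∀ i ∈ s, 1 < ‖a i‖ * τ)
    {y : ℕ → ℂ} (h : aeval shift (∏ i ∈ s, (1 - C (a i) * X)) y = 0) :
    ∃ K, ∀ n, ‖y n‖ ≤ K * τ ^ n := by
  classical
  induction s using Finset.induction_on generalizing y with
  | empty => exact ⟨0, fun n => by
      have : y = 0 := by simpa using h
      simp [this]⟩
  | insert i s hi ih =>
    rw [Finset.prod_insert hi, mul_comm, map_mul, Module.End.mul_apply] at h
    obtain ⟨K, hK⟩ := ih (fun j hj => ha j (Finset.mem_insert_of_mem hj)) h
    have hai := ha i (Finset.mem_insert_self i s)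
    -- Since `‖a i‖ ‖y (n+1)‖ ≤ ‖y n‖ + K τ^n`, a bound `K' τ^n` propagates once `K' + K ≤ K' ‖a i‖
    -- τ`; `‖y 0‖` starts the induction.
    refine ⟨max ‖y 0‖ (K / (‖a i‖ * τ - 1)), fun n => ?_⟩
    set K' := max ‖y 0‖ (K / (‖a i‖ * τ - 1))
    have hK' : K ≤ K' * (‖a i‖ * τ - 1) :=
      (div_le_iff₀ (by linarith)).1 (le_max_right _ _)
    have hpos : 0 < ‖a i‖ := by
      by_contra hc
      have : ‖a i‖ = 0 := le_antisymm (not_lt.1 hc) (norm_nonneg _)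
      rw [this] at hai
      linarith
    induction n with
    | zero => simp [K']
    | succ n hn =>
      have h1 := hK n
      rw [aeval_shift_factor] at h1
      have h2 : ‖a i‖ * ‖y (n + 1)‖ ≤ ‖y n‖ + ‖y n - a i * y (n + 1)‖ := by
        rw [← norm_mul, norm_sub_rev]
        calc ‖a i * y (n + 1)‖ = ‖y n + (a i * y (n + 1) - y n)‖ := by congr 1; ring
          _ ≤ _ := norm_add_le _ _
      have hτn : 0 < τ ^ n := pow_pos hτ n
      have h3 : K * τ ^ n ≤ K' * (‖a i‖ * τ - 1) * τ ^ n :=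
        mul_le_mul_of_nonneg_right hK' hτn.le
      have h4 : ‖a i‖ * ‖y (n + 1)‖ ≤ ‖a i‖ * (K' * τ ^ (n + 1)) := by
        calc _ ≤ K' * τ ^ n + K' * (‖a i‖ * τ - 1) * τ ^ n := by linarith
          _ = _ := by ring
      exact le_of_mul_le_mul_left h4 hpos

/-! ### Characteristic polynomial of the balance equations -/

/-- The recurrence satisfied by the decaying solutions of the balance equations. -/
def FullRec (ℓ : ℕ) (p : ℝ) (y : ℕ → ℝ) : Prop :=
  ∀ n, ∑ m ∈ Finset.range (2 * ℓ + 1), jumpProb ℓ p (ℓ - m) * y (n + m) = y (n + ℓ)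

lemma jumpProb_sub {ℓ m : ℕ} (p : ℝ) (hm : m ≤ 2 * ℓ) :
    jumpProb ℓ p (ℓ - m) = ((2 * ℓ).choose m : ℝ) * p ^ (2 * ℓ - m) * (1 - p) ^ m := by
  have h1 : ((ℓ : ℤ) + (ℓ - m)).toNat = 2 * ℓ - m := by omega
  have h2 : ((ℓ : ℤ) - (ℓ - m)).toNat = m := by omega
  rw [jumpProb, if_pos (by omega), h1, h2, Nat.choose_symm hm]

/-- By the binomial theorem the jump probabilities are the coefficients of `(p + qX)^(2ℓ)`. -/
lemma FullRec.aeval_eq_zero {ℓ : ℕ} {p : ℝ} {y : ℕ → ℝ} (hy : FullRec ℓ p y) :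
    aeval shift ((C (p : ℂ) + C (1 - (p : ℂ)) * X) ^ (2 * ℓ) - X ^ ℓ) (fun n => (y n : ℂ)) = 0 := by
  have hexp : (C (p : ℂ) + C (1 - (p : ℂ)) * X) ^ (2 * ℓ)
      = ∑ m ∈ Finset.range (2 * ℓ + 1), C ((jumpProb ℓ p (ℓ - m) : ℝ) : ℂ) * X ^ m := by
    rw [add_comm, add_pow]
    refine Finset.sum_congr rfl fun m hm => ?_
    rw [jumpProb_sub p (by simpa [Nat.lt_succ_iff] using hm)]
    push_cast
    simp only [map_mul, map_pow, mul_pow]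
    simp only [map_natCast]
    ring
  funext n
  rw [hexp, map_sub, map_sum, LinearMap.sub_apply, LinearMap.sum_apply, Pi.sub_apply,
    Finset.sum_apply]
  simp only [aeval_shift_monomial, map_pow, aeval_X, shift_pow_apply, Pi.zero_apply]
  rw [← hy n]
  push_cast
  ring

lemma rootOfUnity_isPrimitiveRoot {ℓ : ℕ} (hℓ : 0 < ℓ) : IsPrimitiveRoot (rootOfUnity ℓ) ℓ := by
  have : rootOfUnity ℓ = Complex.exp (2 * Real.pi * Complex.I / ℓ) := by
    rw [rootOfUnity, show (2 * Real.pi * Complex.I / ℓ : ℂ)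
      = ((2 * Real.pi / ℓ : ℝ) : ℂ) * Complex.I by push_cast; ring, Complex.exp_mul_I]
    push_cast
    rfl
  rw [this]
  exact Complex.isPrimitiveRoot_exp ℓ hℓ.ne'

lemma pow_sub_pow_eq_prod {ℓ : ℕ} (hℓ : 0 < ℓ) (x y : ℂ) :
    x ^ ℓ - y ^ ℓ = ∏ j : Fin ℓ, (x - rootOfUnity ℓ ^ (j : ℕ) * y) := by
  have hω := rootOfUnity_isPrimitiveRoot hℓ
  have := NeZero.of_pos hℓ
  rw [hω.pow_sub_pow_eq_prod_sub_mul x y hℓ, Fin.prod_univ_eq_prod_range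
    (fun j => x - rootOfUnity ℓ ^ j * y) ℓ]
  symm
  refine Finset.prod_bij (fun j _ => rootOfUnity ℓ ^ j) ?_ ?_ ?_ fun _ _ => rfl
  · intro j _
    rw [Polynomial.mem_nthRootsFinset hℓ, ← pow_mul, mul_comm, pow_mul, hω.pow_eq_one, one_pow]
  · intro i hi j hj h
    exact hω.pow_inj (Finset.mem_range.1 hi) (Finset.mem_range.1 hj) h
  · intro z hz
    rw [Polynomial.mem_nthRootsFinset hℓ] at hz
    obtain ⟨i, hi, h⟩ := hω.eq_pow_of_pow_eq_one hz
    exact ⟨i, Finset.mem_range.2 hi, h⟩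

/-! ### Location of the roots -/

section RootPairs

variable {ℓ : ℕ} {p : ℝ} {σ μ : Fin ℓ → ℂ}

lemma AreRootPairs.prod_eq (h : AreRootPairs ℓ p σ μ) (j : Fin ℓ) :
    (p : ℂ) ^ 2 * (σ j * μ j) = (1 - (p : ℂ)) ^ 2 := by
  have := (h j).1 0
  linear_combination -this

/-- This is the quadratic at `1/x` multiplied by `x²`; combining its values at 0 and 1 covers `x =
0` as well. -/
lemma AreRootPairs.reversed (h : AreRootPairs ℓ p σ μ) (j : Fin ℓ) (x : ℂ) :
    ((p : ℂ) + (1 - p) * x) ^ 2 - rootOfUnity ℓ ^ (j : ℕ) * x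
      = (p : ℂ) ^ 2 * ((1 - σ j * x) * (1 - μ j * x)) := by
  have h0 := (h j).1 0
  have h1 := (h j).1 1
  linear_combination x * h1 + (x ^ 2 - x) * h0

lemma AreRootPairs.polynomial_eq (h : AreRootPairs ℓ p σ μ) (hℓ : 0 < ℓ) :
    (C (p : ℂ) + C (1 - (p : ℂ)) * X) ^ (2 * ℓ) - X ^ ℓ
      = C ((p : ℂ) ^ (2 * ℓ)) *
        ((∏ j : Fin ℓ, (1 - C (σ j) * X)) * ∏ j : Fin ℓ, (1 - C (μ j) * X)) := by
  refine Polynomial.funext fun x => ?_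
  simp only [eval_sub, eval_pow, eval_add, eval_C, eval_mul, eval_X, eval_prod, eval_one]
  rw [pow_mul, pow_sub_pow_eq_prod hℓ, ← Finset.prod_mul_distrib]
  simp only [h.reversed]
  rw [Finset.prod_mul_distrib]
  simp [pow_mul]

lemma AreRootPairs.norm_prod (h : AreRootPairs ℓ p σ μ) (j : Fin ℓ) :
    p ^ 2 * (‖σ j‖ * ‖μ j‖) = (1 - p) ^ 2 := by
  have := congrArg norm (h.prod_eq j)
  rw [norm_mul, norm_mul, norm_pow, norm_pow, ← Complex.ofReal_one, ← Complex.ofReal_sub,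
    Complex.norm_real, Complex.norm_real, Real.norm_eq_abs, Real.norm_eq_abs, sq_abs, sq_abs] at this
  exact this

lemma norm_rootOfUnity_pow (hℓ : 0 < ℓ) (j : ℕ) : ‖rootOfUnity ℓ ^ j‖ = 1 := by
  rw [norm_pow, (rootOfUnity_isPrimitiveRoot hℓ).norm'_eq_one hℓ.ne', one_pow]

/-- With `s = |σ_j|`, the root equation gives `s ≤ (ps + q)²`, that is `(s - 1)(p²s - q²) ≥ 0`. If
`s > 1` then `s ≥ q²/p² = |σ_j μ_j|`, which contradicts `|μ_j| ≥ s > 1`. -/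
lemma AreRootPairs.norm_le (h : AreRootPairs ℓ p σ μ) (hp : 0 < p) (hp2 : p < 1 - p)
    (j : Fin ℓ) : ‖σ j‖ ≤ 1 := by
  have hℓ : 0 < ℓ := j.pos
  by_contra! hc
  have hprod := h.norm_prod j
  have hroot : (p * σ j + (1 - (p : ℂ))) ^ 2 = rootOfUnity ℓ ^ (j : ℕ) * σ j := by
    have := (h j).1 (σ j)
    linear_combination this
  have hn : ‖σ j‖ ≤ (p * ‖σ j‖ + (1 - p)) ^ 2 := by
    have h1 := congrArg norm hroot
    rw [norm_pow, norm_mul, norm_rootOfUnity_pow hℓ, one_mul] at h1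
    refine h1.symm.le.trans ?_
    gcongr
    refine (norm_add_le _ _).trans (le_of_eq ?_)
    rw [norm_mul, ← Complex.ofReal_one, ← Complex.ofReal_sub, Complex.norm_real,
      Complex.norm_real, Real.norm_of_nonneg hp.le, Real.norm_of_nonneg (by linarith)]
  have h2 : 0 ≤ (‖σ j‖ - 1) * (p ^ 2 * ‖σ j‖ - (1 - p) ^ 2) := by
    nlinarith
  have h3 : (1 - p) ^ 2 ≤ p ^ 2 * ‖σ j‖ := by
    by_contra! h4
    nlinarith [mul_pos (sub_pos.2 hc) (sub_pos.2 h4)]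
  have h5 : p ^ 2 * ‖σ j‖ < p ^ 2 * (‖σ j‖ * ‖μ j‖) := by
    have : 1 < ‖μ j‖ := hc.trans_le (h j).2
    have h6 : 0 < p ^ 2 * ‖σ j‖ := by positivity
    nlinarith
  linarith

lemma AreRootPairs.le_norm (h : AreRootPairs ℓ p σ μ) (hp : 0 < p) (hp2 : p < 1 - p)
    (j : Fin ℓ) : (1 - p) ^ 2 / p ^ 2 ≤ ‖μ j‖ := by
  rw [div_le_iff₀ (by positivity), ← h.norm_prod j]
  have := mul_le_of_le_one_left (norm_nonneg (μ j)) (h.norm_le hp hp2 j)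
  nlinarith [sq_nonneg p]

lemma one_lt_ratio (hp : 0 < p) (hp2 : p < 1 - p) : 1 < (1 - p) ^ 2 / p ^ 2 := by
  rw [one_lt_div (by positivity)]
  nlinarith

lemma AreRootPairs.one_lt_norm (h : AreRootPairs ℓ p σ μ) (hp : 0 < p) (hp2 : p < 1 - p)
    (j : Fin ℓ) : 1 < ‖μ j‖ :=
  (one_lt_ratio hp hp2).trans_le (h.le_norm hp hp2 j)

lemma AreRootPairs.ne_zero (h : AreRootPairs ℓ p σ μ) (hp : 0 < p) (hp2 : p < 1 - p)
    (j : Fin ℓ) : μ j ≠ 0 := by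
  have := h.one_lt_norm hp hp2 j
  intro h0
  simp [h0] at this
  linarith

lemma AreRootPairs.ne_one (h : AreRootPairs ℓ p σ μ) (hp : 0 < p) (hp2 : p < 1 - p)
    (j : Fin ℓ) : μ j ≠ 1 := by
  have := h.one_lt_norm hp hp2 j
  intro h0
  simp [h0] at this

/-- For index 0 the number 1 is a root; it must be `σ`, because `|μ| > 1`, and the product of the
roots gives `μ`. -/
lemma AreRootPairs.first_eq (h : AreRootPairs ℓ p σ μ) (hp : 0 < p) (hp2 : p < 1 - p)
    (hℓ : 0 < ℓ) : μ ⟨0, hℓ⟩ = (((1 - p) ^ 2 / p ^ 2 : ℝ) : ℂ) := by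
  have h1 := (h ⟨0, hℓ⟩).1 1
  have hp0 : (p : ℂ) ≠ 0 := by exact_mod_cast hp.ne'
  have h2 : (p : ℂ) ^ 2 * ((1 - σ ⟨0, hℓ⟩) * (1 - μ ⟨0, hℓ⟩)) = 0 := by
    rw [← h1]
    simp
  have h3 : σ ⟨0, hℓ⟩ = 1 := by
    have h4 : 1 - μ ⟨0, hℓ⟩ ≠ 0 := sub_ne_zero.2 (h.ne_one hp hp2 _).symm
    have : 1 - σ ⟨0, hℓ⟩ = 0 := by simpa [hp0, h4] using h2
    linear_combination -this
  have h5 := h.prod_eq ⟨0, hℓ⟩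
  rw [h3, one_mul] at h5
  push_cast
  rw [eq_div_iff (pow_ne_zero 2 hp0), ← h5]
  ring

/-- Equality forces `|σ_j| = 1` and `|pσ_j + q| = 1`. Strict convexity of the disk then gives `σ_j =
1`, so `ω^j = 1` with `0 < j < ℓ`. -/
lemma AreRootPairs.lt_norm (h : AreRootPairs ℓ p σ μ) (hp : 0 < p) (hp2 : p < 1 - p)
    (j : Fin ℓ) (hj : (j : ℕ) ≠ 0) : (1 - p) ^ 2 / p ^ 2 < ‖μ j‖ := by
  have hℓ : 0 < ℓ := j.pos
  refine lt_of_le_of_ne (h.le_norm hp hp2 j) fun heq => ?_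
  have hσ : ‖σ j‖ = 1 := by
    have h1 := h.norm_prod j
    have h2 : p ^ 2 * ‖μ j‖ = (1 - p) ^ 2 := by
      rw [← heq]
      field_simp
    have h3 : 0 < (1 - p) ^ 2 := by nlinarith
    have h4 : (1 - p) ^ 2 * ‖σ j‖ = (1 - p) ^ 2 * 1 := by
      rw [← h2]; linear_combination h1 - h2
    exact mul_left_cancel₀ h3.ne' h4
  have hroot : (p * σ j + (1 - (p : ℂ))) ^ 2 = rootOfUnity ℓ ^ (j : ℕ) * σ j := by
    have := (h j).1 (σ j)
    linear_combination this
  have hn : ‖p * σ j + (1 - (p : ℂ))‖ ^ 2 = 1 := by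
    rw [← norm_pow, hroot, norm_mul, norm_rootOfUnity_pow hℓ, hσ, one_mul]
  have hs : (σ j).re ^ 2 + (σ j).im ^ 2 = 1 := by
    have := Complex.sq_norm (σ j)
    rw [hσ, Complex.normSq_apply] at this
    nlinarith
  have hn2 : (p * (σ j).re + (1 - p)) ^ 2 + (p * (σ j).im) ^ 2 = 1 := by
    rw [Complex.sq_norm, Complex.normSq_apply] at hn
    simp at hn
    nlinarith
  have hre : (σ j).re = 1 := by
    have h3 : 2 * p * (1 - p) * ((σ j).re - 1) = 0 := by
      linear_combination hn2 - p ^ 2 * hs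
    have h4 : 2 * p * (1 - p) ≠ 0 := by
      have : 0 < 1 - p := by linarith
      positivity
    have := (mul_eq_zero.1 h3).resolve_left h4
    linarith
  have him : (σ j).im = 0 := by
    rw [hre] at hs
    nlinarith
  have hσ1 : σ j = 1 := Complex.ext (by simpa using hre) (by simpa using him)
  rw [hσ1] at hroot
  have hω : rootOfUnity ℓ ^ (j : ℕ) = 1 := by linear_combination -hroot
  have := (rootOfUnity_isPrimitiveRoot hℓ).dvd_of_pow_eq_one _ hω
  exact hj (Nat.eq_zero_of_dvd_of_lt this j.2)

/-- Null solutions of the balance equations satisfy the recurrence of order `ℓ`. -/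
lemma FullRec.reduced {y : ℕ → ℝ} (hy : FullRec ℓ p y) (hlim : Tendsto y atTop (𝓝 0))
    (h : AreRootPairs ℓ p σ μ) (hp : 0 < p) (hp2 : p < 1 - p) (hℓ : 0 < ℓ) :
    aeval shift (∏ j : Fin ℓ, (1 - C (μ j) * X)) (fun n => (y n : ℂ)) = 0 := by
  have h1 := hy.aeval_eq_zero
  have hp0 : (p : ℂ) ≠ 0 := by exact_mod_cast hp.ne'
  have hlim' : Tendsto (fun n => (y n : ℂ)) atTop (𝓝 0) := by
    simpa [Function.comp_def] using (Complex.continuous_ofReal.tendsto 0).comp hlim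
  rw [h.polynomial_eq hℓ, map_mul, Module.End.mul_apply, aeval_C, Module.algebraMap_end_apply,
    smul_eq_zero_iff_right (pow_ne_zero _ hp0), map_mul, Module.End.mul_apply] at h1
  -- What the factors `1 - σ_j S` annihilate is the null sequence `∏ (1 - μ_j S) y`.
  exact eq_zero_of_prod_factor _ _ (fun j _ => h.norm_le hp hp2 j)
    (tendsto_aeval_shift _ hlim') h1

end RootPairs

/-! ### Banded stochastic matrices -/

/-- The rows of `M` vanish more than `a` places to the right of the diagonal. -/
def UpperBanded (a : ℕ) (M : ℕ → ℕ → ℝ) : Prop := ∀ i j, i + a < j → M i j = 0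

lemma infMul_eq_sum {M N : ℕ → ℕ → ℝ} {i B : ℕ} (h : ∀ k, B ≤ k → M i k = 0) (j : ℕ) :
    infMul M N i j = ∑ k ∈ Finset.range B, M i k * N k j :=
  tsum_eq_sum fun k hk => by rw [h k (by simpa using hk), zero_mul]

lemma UpperBanded.infMul_eq {a : ℕ} {M : ℕ → ℕ → ℝ} (hM : UpperBanded a M) (N : ℕ → ℕ → ℝ)
    (i j : ℕ) {B : ℕ} (hB : i + a < B) :
    infMul M N i j = ∑ k ∈ Finset.range B, M i k * N k j :=
  infMul_eq_sum (fun k hk => hM i k (by omega)) j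

lemma UpperBanded.infMul {a b : ℕ} {M N : ℕ → ℕ → ℝ} (hM : UpperBanded a M)
    (hN : UpperBanded b N) : UpperBanded (a + b) (infMul M N) := fun i j hij => by
  rw [hM.infMul_eq N i j (Nat.lt_succ_self _)]
  refine Finset.sum_eq_zero fun k hk => ?_
  rw [hN k j (by have := Finset.mem_range.1 hk; omega), mul_zero]

lemma infMul_assoc {a b : ℕ} {M N : ℕ → ℕ → ℝ} (hM : UpperBanded a M) (hN : UpperBanded b N)
    (L : ℕ → ℕ → ℝ) : infMul (infMul M N) L = infMul M (infMul N L) := by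
  funext i j
  rw [(hM.infMul hN).infMul_eq L i j (Nat.lt_succ_self _), hM.infMul_eq _ i j (Nat.lt_succ_self _)]
  calc _ = ∑ l ∈ Finset.range (i + (a + b) + 1), ∑ k ∈ Finset.range (i + a + 1),
        M i k * (N k l * L l j) := by
        refine Finset.sum_congr rfl fun l _ => ?_
        rw [hM.infMul_eq N i l (Nat.lt_succ_self _), Finset.sum_mul]
        exact Finset.sum_congr rfl fun k _ => mul_assoc _ _ _
    _ = _ := by
        rw [Finset.sum_comm]
        refine Finset.sum_congr rfl fun k hk => ?_
        rw [hN.infMul_eq L k j (B := i + (a + b) + 1)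
          (by have := Finset.mem_range.1 hk; omega), Finset.mul_sum]

/-- A stochastic matrix whose rows vanish more than `a` places to the right of the diagonal. -/
structure BandedStochastic (a : ℕ) (M : ℕ → ℕ → ℝ) : Prop where
  banded : UpperBanded a M
  nonneg : ∀ i j, 0 ≤ M i j
  sum_row : ∀ i B, i + a < B → ∑ j ∈ Finset.range B, M i j = 1

lemma BandedStochastic.infMul {a b : ℕ} {M N : ℕ → ℕ → ℝ} (hM : BandedStochastic a M)
    (hN : BandedStochastic b N) : BandedStochastic (a + b) (infMul M N) where
  banded := hM.banded.infMul hN.banded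
  nonneg i j := tsum_nonneg fun k => mul_nonneg (hM.nonneg i k) (hN.nonneg k j)
  sum_row i B hB := by
    simp only [hM.banded.infMul_eq N i _ (Nat.lt_succ_self _)]
    rw [Finset.sum_comm, ← hM.sum_row i (i + a + 1) (by omega)]
    refine Finset.sum_congr rfl fun k hk => ?_
    rw [← Finset.mul_sum, hN.sum_row k B (by have := Finset.mem_range.1 hk; omega), mul_one]

lemma BandedStochastic.infPow {a : ℕ} {M : ℕ → ℕ → ℝ} (hM : BandedStochastic a M) (n : ℕ) :
    BandedStochastic (n * a) (infPow M n) := by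
  induction n with
  | zero =>
    refine ⟨fun i j h => if_neg (by omega), fun i j => ?_, fun i B hB => ?_⟩
    · simp only [TrafficLight.infPow]
      split_ifs <;> norm_num
    · simp only [TrafficLight.infPow]
      rw [Finset.sum_ite_eq, if_pos (Finset.mem_range.2 (by omega))]
  | succ n ih => simpa [Nat.succ_mul, TrafficLight.infPow] using ih.infMul hM

lemma redStep_stochastic {p : ℝ} (hp : 0 ≤ p) (hp1 : p ≤ 1) :
    BandedStochastic 1 (redStep p) where
  banded i j h := by rw [redStep, if_neg (by omega), if_neg (by omega)]
  nonneg i j := by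
    rw [redStep]
    split_ifs <;> linarith
  sum_row i B hB := by
    have hsub : ({i, i + 1} : Finset ℕ) ⊆ Finset.range B := by
      intro k hk
      simp only [Finset.mem_insert, Finset.mem_singleton] at hk
      exact Finset.mem_range.2 (by omega)
    rw [← Finset.sum_subset hsub fun k _ hk => by
      simp only [Finset.mem_insert, Finset.mem_singleton, not_or] at hk
      rw [redStep, if_neg hk.1, if_neg hk.2], Finset.sum_pair (by omega)]
    simp [redStep]

lemma greenStep_stochastic {p : ℝ} (hp : 0 ≤ p) (hp1 : p ≤ 1) :
    BandedStochastic 0 (greenStep p) where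
  banded i j h := by
    rw [greenStep]
    split_ifs <;> first | omega | rfl
  nonneg i j := by
    rw [greenStep]
    split_ifs <;> linarith
  sum_row i B hB := by
    rcases i with _ | i
    · rw [Finset.sum_eq_single 0]
      · simp [greenStep]
      · intro k _ hk
        simp [greenStep, hk]
      · intro h
        exact absurd (Finset.mem_range.2 (by omega)) h
    · have hsub : ({i, i + 1} : Finset ℕ) ⊆ Finset.range B := by
        intro k hk
        simp only [Finset.mem_insert, Finset.mem_singleton] at hk
        exact Finset.mem_range.2 (by omega)
      rw [← Finset.sum_subset hsub fun k _ hk => by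
        simp only [Finset.mem_insert, Finset.mem_singleton, not_or] at hk
        rw [greenStep, if_neg (by omega), if_neg hk.2, if_neg (by omega)],
        Finset.sum_pair (by omega)]
      simp [greenStep]

lemma cycleMatrix_stochastic (ℓ : ℕ) {p : ℝ} (hp : 0 ≤ p) (hp1 : p ≤ 1) :
    BandedStochastic ℓ (cycleMatrix ℓ p) := by
  simpa [cycleMatrix] using
    ((redStep_stochastic hp hp1).infPow ℓ).infMul ((greenStep_stochastic hp hp1).infPow ℓ)

/-! ### Binomial entries of the transition matrix -/

/-- The probability that `n` trials with success probability `p` have `k` successes. -/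
def binomProb (p : ℝ) (n k : ℕ) : ℝ := (n.choose k : ℝ) * p ^ k * (1 - p) ^ (n - k)

lemma binomProb_succ_zero (p : ℝ) (n : ℕ) :
    binomProb p (n + 1) 0 = binomProb p n 0 * (1 - p) := by
  simp [binomProb, pow_succ]

lemma binomProb_succ_succ (p : ℝ) (n k : ℕ) :
    binomProb p (n + 1) (k + 1) = binomProb p n k * p + binomProb p n (k + 1) * (1 - p) := by
  simp only [binomProb]
  rcases lt_trichotomy k n with h | rfl | h
  · obtain ⟨d, rfl⟩ := Nat.exists_eq_add_of_lt h
    rw [Nat.choose_succ_succ, show k + d + 1 + 1 - (k + 1) = d + 1 by omega,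
      show k + d + 1 - k = d + 1 by omega, show k + d + 1 - (k + 1) = d by omega]
    push_cast
    ring
  · simp [pow_succ]
  · rw [Nat.choose_eq_zero_of_lt (by omega), Nat.choose_eq_zero_of_lt (by omega),
      Nat.choose_eq_zero_of_lt (by omega)]
    simp

lemma infPow_redStep (p : ℝ) (n i j : ℕ) :
    infPow (redStep p) n i j = if i ≤ j then binomProb p n (j - i) else 0 := by
  induction n generalizing j with
  | zero =>
    simp only [infPow]
    rcases lt_trichotomy i j with h | rfl | h
    · rw [if_neg h.ne, if_pos h.le, binomProb, Nat.choose_eq_zero_of_lt (by omega)]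
      simp
    · simp [binomProb]
    · rw [if_neg h.ne', if_neg (by omega)]
  | succ n ih =>
    rw [infPow, infMul]
    rcases j with _ | j
    · rw [tsum_eq_single 0 fun k hk => by
        rw [redStep, if_neg (Ne.symm hk), if_neg (by omega), mul_zero], ih]
      rcases Nat.eq_zero_or_pos i with rfl | h
      · simp [redStep, binomProb_succ_zero]
      · rw [if_neg (by omega), if_neg (by omega), zero_mul]
    · rw [tsum_eq_sum (s := {j, j + 1}) fun k hk => by
        simp only [Finset.mem_insert, Finset.mem_singleton, not_or] at hk
        rw [redStep, if_neg (by omega), if_neg (by omega), mul_zero],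
        Finset.sum_pair (by omega), ih, ih]
      simp only [redStep, if_neg (show j + 1 ≠ j by omega), if_true]
      rcases lt_trichotomy i (j + 1) with h | rfl | h
      · rw [if_pos (by omega), if_pos (by omega), if_pos (by omega),
          show j + 1 - i = (j - i) + 1 by omega, binomProb_succ_succ]
      · simp [binomProb_succ_zero]
      · rw [if_neg (by omega), if_neg (by omega), if_neg (by omega)]
        simp

/-- Measured by `m + j`, a green step moves like a red one: up with probability `p`, unchanged
otherwise. A column `j > 0` of a green step involves only rows `j` and `j + 1`, so the empty state
never intervenes. -/
lemma infMul_infPow {p : ℝ} (hp : 0 ≤ p) (hp1 : p ≤ 1) (n m i j : ℕ) (hj : 0 < j) :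
    infMul (infPow (redStep p) n) (infPow (greenStep p) m) i j
      = if i ≤ m + j then binomProb p (n + m) (m + j - i) else 0 := by
  induction m generalizing j with
  | zero =>
    rw [infMul, tsum_eq_single j fun k hk => by simp [infPow, hk], infPow_redStep]
    simp [infPow]
  | succ m ih =>
    rw [infPow, ← infMul_assoc ((redStep_stochastic hp hp1).infPow n).banded
      ((greenStep_stochastic hp hp1).infPow m).banded, infMul,
      tsum_eq_sum (s := {j, j + 1}) fun k hk => by
        simp only [Finset.mem_insert, Finset.mem_singleton, not_or] at hk
        rw [greenStep]
        split_ifs <;> first | omega | rw [mul_zero],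
      Finset.sum_pair (by omega), ih j hj, ih (j + 1) (by omega)]
    simp only [greenStep, if_neg hj.ne', if_neg (show j + 1 ≠ 0 by omega),
      if_neg (show j ≠ j + 1 by omega), if_true]
    rcases lt_trichotomy i (m + j + 1) with h | rfl | h
    · rw [if_pos (by omega), if_pos (by omega), if_pos (by omega),
        show m + (j + 1) - i = (m + j - i) + 1 by omega,
        show m + 1 + j - i = (m + j - i) + 1 by omega, ← add_assoc, binomProb_succ_succ]
    · rw [if_neg (by omega), if_pos (by omega), if_pos (by omega),
        show m + (j + 1) - (m + j + 1) = 0 by omega,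
        show m + 1 + j - (m + j + 1) = 0 by omega, ← add_assoc, binomProb_succ_zero]
      simp
    · rw [if_neg (by omega), if_neg (by omega), if_neg (by omega)]
      simp

lemma jumpProb_eq_zero {ℓ : ℕ} (p : ℝ) {d : ℤ} (h : d < -ℓ ∨ (ℓ : ℤ) < d) :
    jumpProb ℓ p d = 0 := if_neg (by omega)

lemma jumpProb_nonneg (ℓ : ℕ) {p : ℝ} (hp : 0 ≤ p) (hp1 : p ≤ 1) (d : ℤ) :
    0 ≤ jumpProb ℓ p d := by
  have : 0 ≤ 1 - p := by linarith
  rw [jumpProb]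
  split_ifs <;> positivity

lemma cycleMatrix_eq {ℓ : ℕ} {p : ℝ} (hp : 0 ≤ p) (hp1 : p ≤ 1) (i : ℕ) {j : ℕ} (hj : 0 < j) :
    cycleMatrix ℓ p i j = jumpProb ℓ p (j - i) := by
  rw [cycleMatrix, infMul_infPow hp hp1 ℓ ℓ i j hj]
  split_ifs with h
  · rw [binomProb, jumpProb, ← two_mul]
    split_ifs with h2
    · rw [show ((ℓ : ℤ) + (j - i)).toNat = ℓ + j - i by omega,
        show ((ℓ : ℤ) - (j - i)).toNat = 2 * ℓ - (ℓ + j - i) by omega]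
    · rw [Nat.choose_eq_zero_of_lt (by omega)]
      simp
  · rw [jumpProb_eq_zero p (by omega)]

/-! ### Balance equations as a recurrence -/

/-- The sequence `π` delayed by `ℓ` places. -/
def delay (ℓ : ℕ) (π : ℕ → ℝ) : ℕ → ℝ := fun n => if n < ℓ then 0 else π (n - ℓ)

lemma delay_add (ℓ : ℕ) (π : ℕ → ℝ) (n : ℕ) : delay ℓ π (n + ℓ) = π n := by
  rw [delay, if_neg (by omega), Nat.add_sub_cancel]

lemma sum_mul_jumpProb (ℓ : ℕ) (p : ℝ) (π : ℕ → ℝ) (j : ℕ) :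
    ∑ i ∈ Finset.range (j + ℓ + 1), π i * jumpProb ℓ p (j - i)
      = ∑ m ∈ Finset.range (2 * ℓ + 1), jumpProb ℓ p (ℓ - m) * delay ℓ π (j + m) := by
  have h1 := Finset.sum_range_add
    (fun N : ℕ => jumpProb ℓ p (j + ℓ - N) * delay ℓ π N) ℓ (j + ℓ + 1)
  have h2 := Finset.sum_range_add
    (fun N : ℕ => jumpProb ℓ p (j + ℓ - N) * delay ℓ π N) j (2 * ℓ + 1)
  have h0 : ∑ N ∈ Finset.range ℓ, jumpProb ℓ p (j + ℓ - N) * delay ℓ π N = 0 :=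
    Finset.sum_eq_zero fun N hN => by rw [delay, if_pos (Finset.mem_range.1 hN), mul_zero]
  have h0' : ∑ N ∈ Finset.range j, jumpProb ℓ p (j + ℓ - N) * delay ℓ π N = 0 :=
    Finset.sum_eq_zero fun N hN => by
      rw [jumpProb_eq_zero p (by have := Finset.mem_range.1 hN; omega), zero_mul]
  rw [h0, zero_add] at h1
  rw [h0', zero_add, show j + (2 * ℓ + 1) = ℓ + (j + ℓ + 1) by ring, h1] at h2
  calc _ = _ := Finset.sum_congr rfl fun i _ => by
        rw [add_comm ℓ i, delay_add, mul_comm]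
        congr 2
        push_cast
        ring
    _ = _ := h2
    _ = _ := Finset.sum_congr rfl fun m _ => by
        congr 2
        push_cast
        ring

lemma hasSum_cycleMatrix {ℓ : ℕ} {p : ℝ} (hp : 0 ≤ p) (hp1 : p ≤ 1) (π : ℕ → ℝ) {j : ℕ}
    (hj : 0 < j) :
    HasSum (fun i => π i * cycleMatrix ℓ p i j)
      (∑ m ∈ Finset.range (2 * ℓ + 1), jumpProb ℓ p (ℓ - m) * delay ℓ π (j + m)) := by
  rw [← sum_mul_jumpProb]
  simp only [cycleMatrix_eq hp hp1 _ hj]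
  refine hasSum_sum_of_ne_finset_zero fun i hi => ?_
  rw [jumpProb_eq_zero p (by have := mt Finset.mem_range.2 hi; omega), mul_zero]

/-- The `ℓ` zeros stand for the missing negative states. The offset `n + 1` omits the equation at
state 0, the only one that is not Toeplitz. -/
lemma balance_iff {ℓ : ℕ} {p : ℝ} (hp : 0 ≤ p) (hp1 : p ≤ 1) (π : ℕ → ℝ) :
    (∀ j, 0 < j → HasSum (fun i => π i * cycleMatrix ℓ p i j) (π j))
      ↔ FullRec ℓ p (fun n => delay ℓ π (n + 1)) := by
  constructor
  · intro h n
    have h1 := (hasSum_cycleMatrix hp hp1 π n.succ_pos).unique (h _ n.succ_pos)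
    beta_reduce
    rw [show n + ℓ + 1 = n + 1 + ℓ by ring, delay_add, ← h1]
    refine Finset.sum_congr rfl fun m _ => ?_
    rw [show n + m + 1 = n.succ + m by omega]
  · intro h j hj
    obtain ⟨n, rfl⟩ := Nat.exists_eq_succ_of_ne_zero hj.ne'
    have h1 := h n
    beta_reduce at h1
    rw [show n + ℓ + 1 = n + 1 + ℓ by ring, delay_add] at h1
    rw [Nat.succ_eq_add_one, ← h1]
    convert hasSum_cycleMatrix hp hp1 π n.succ_pos using 4
    omega

/-- The balance equation at `0` follows from the others by conservation of mass. -/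
lemma balance_zero {a : ℕ} {P : ℕ → ℕ → ℝ} (hP : BandedStochastic a P) {π : ℕ → ℝ}
    (hπ : ∀ n, 0 ≤ π n) (hs : Summable π)
    (h : ∀ j, 0 < j → HasSum (fun i => π i * P i j) (π j)) :
    HasSum (fun i => π i * P i 0) (π 0) := by
  have hrow : ∀ i, HasSum (fun j => π i * P i j) (π i) := fun i => by
    have : HasSum (fun j => P i j) 1 := by
      rw [← hP.sum_row i (i + a + 1) (by omega)]
      exact hasSum_sum_of_ne_finset_zero fun j hj =>
        hP.banded i j (by have := mt Finset.mem_range.2 hj; omega)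
    simpa using this.mul_left (π i)
  have hsum : Summable fun x : ℕ × ℕ => π x.1 * P x.1 x.2 :=
    (summable_prod_of_nonneg fun x => mul_nonneg (hπ _) (hP.nonneg _ _)).2
      ⟨fun i => (hrow i).summable, by simpa only [(hrow _).tsum_eq] using hs⟩
  have htot := hsum.hasSum.prod_fiberwise hrow
  have hcol : ∀ j, Summable fun i => π i * P i j := fun j =>
    hsum.prod_symm.prod_factor j
  have htot' : HasSum (fun j => ∑' i, π i * P i j) (∑' i, π i) := by
    rw [htot.tsum_eq]
    have h1 := ((Equiv.prodComm ℕ ℕ).hasSum_iff).2 hsum.hasSum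
    exact h1.prod_fiberwise fun j => (hcol j).hasSum
  have h0 : ∑' i, π i * P i 0 = π 0 := by
    have e1 := htot'.tsum_eq
    rw [htot'.summable.tsum_eq_zero_add, hs.tsum_eq_zero_add] at e1
    have e2 : ∑' j, ∑' i, π i * P i (j + 1) = ∑' j, π (j + 1) :=
      tsum_congr fun j => (h _ j.succ_pos).tsum_eq
    rw [e2] at e1
    linarith
  rw [← h0]
  exact (hcol 0).hasSum

/-! ### Powers of the rate matrix -/

/-- Gelfand's formula gives `‖a ^ n‖ ≤ c ^ n` eventually, for a `c` between the spectral radius and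
1. -/
lemma tendsto_pow_of_spectralRadius_lt_one {A : Type*} [NormedRing A] [NormedAlgebra ℂ A]
    [CompleteSpace A] {a : A} (ha : spectralRadius ℂ a < 1) :
    Tendsto (fun n : ℕ => a ^ n) atTop (𝓝 0) := by
  obtain ⟨c, hc, hc1⟩ := ENNReal.lt_iff_exists_nnreal_btwn.1 ha
  have hc1' : c < 1 := by exact_mod_cast hc1
  have hev := (spectrum.pow_nnnorm_pow_one_div_tendsto_nhds_spectralRadius a).eventually_lt_const hc
  refine squeeze_zero_norm' (a := fun n => (c : ℝ) ^ n) ?_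
    (tendsto_pow_atTop_nhds_zero_of_lt_one c.2 (by exact_mod_cast hc1'))
  filter_upwards [hev, eventually_gt_atTop 0] with n hn hn0
  have hn' : (0 : ℝ) < n := by exact_mod_cast hn0
  have h1 := ENNReal.rpow_le_rpow hn.le hn'.le
  rw [← ENNReal.rpow_mul, one_div_mul_cancel hn'.ne', ENNReal.rpow_one, ENNReal.rpow_natCast] at h1
  exact_mod_cast h1

lemma tendsto_matrix_pow {ℓ : ℕ} (hℓ : 0 < ℓ) {M : Matrix (Fin ℓ) (Fin ℓ) ℂ}
    (hM : ∀ z ∈ spectrum ℂ M, ‖z‖ < 1) (i j : Fin ℓ) :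
    Tendsto (fun k : ℕ => (M ^ k) i j) atTop (𝓝 0) := by
  let _ := Matrix.linftyOpNormedRing (n := Fin ℓ) (α := ℂ)
  let _ := Matrix.linftyOpNormedAlgebra (n := Fin ℓ) (R := ℂ) (α := ℂ)
  have : Nonempty (Fin ℓ) := ⟨⟨0, hℓ⟩⟩
  have : CompleteSpace (Matrix (Fin ℓ) (Fin ℓ) ℂ) := FiniteDimensional.complete ℂ _
  have h1 : spectralRadius ℂ M < 1 := by
    have := spectrum.spectralRadius_lt_of_forall_lt M (r := 1) fun z hz => by
      have := hM z hz
      rw [← coe_nnnorm] at this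
      exact_mod_cast this
    exact_mod_cast this
  have h2 := tendsto_pow_of_spectralRadius_lt_one h1
  have h3 : Continuous fun N : Matrix (Fin ℓ) (Fin ℓ) ℂ => N i j :=
    (Matrix.entryLinearMap ℂ ℂ i j).continuous_of_finiteDimensional
  exact (h3.tendsto 0).comp h2

/-- The row `i` of the block row `(I, R, R², …)`. -/
def rowSeq {ℓ : ℕ} (R : Matrix (Fin ℓ) (Fin ℓ) ℝ) (i : Fin ℓ) (n : ℕ) : ℝ :=
  (R ^ (n / ℓ)) i ⟨n % ℓ, Nat.mod_lt _ i.pos⟩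

lemma rowSeq_add {ℓ : ℕ} (R : Matrix (Fin ℓ) (Fin ℓ) ℝ) (i : Fin ℓ) (k : ℕ) (j : Fin ℓ) :
    rowSeq R i (k * ℓ + j) = (R ^ k) i j := by
  have h1 : (k * ℓ + j) / ℓ = k := by
    rw [mul_comm, Nat.mul_add_div i.pos, Nat.div_eq_of_lt j.2, add_zero]
  have h2 : (k * ℓ + j) % ℓ = j := by
    rw [mul_comm, Nat.mul_add_mod, Nat.mod_eq_of_lt j.2]
  simp only [rowSeq, h1, h2]

lemma rowSeq_lt {ℓ : ℕ} (R : Matrix (Fin ℓ) (Fin ℓ) ℝ) (i j : Fin ℓ) :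
    rowSeq R i j = if i = j then 1 else 0 := by
  have := rowSeq_add R i 0 j
  rwa [zero_mul, zero_add, pow_zero, Matrix.one_apply] at this

lemma rowSeq_of_lt {ℓ : ℕ} (R : Matrix (Fin ℓ) (Fin ℓ) ℝ) (i : Fin ℓ) {k : ℕ} (hk : k < ℓ) :
    rowSeq R i k = if (i : ℕ) = k then 1 else 0 := by
  have := rowSeq_lt R i ⟨k, hk⟩
  simpa [Fin.ext_iff] using this

lemma rowSeq_tendsto {ℓ : ℕ} {R : Matrix (Fin ℓ) (Fin ℓ) ℝ}
    (hR : ∀ z ∈ spectrum ℂ (R.map Complex.ofReal), ‖z‖ < 1) (i : Fin ℓ) :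
    Tendsto (rowSeq R i) atTop (𝓝 0) := by
  have hℓ := i.pos
  have hpow : ∀ j, Tendsto (fun k : ℕ => |(R ^ k) i j|) atTop (𝓝 0) := fun j => by
    have h := (tendsto_matrix_pow hℓ hR i j).norm
    rw [norm_zero] at h
    refine h.congr fun k => ?_
    have : (R.map Complex.ofReal) ^ k = (R ^ k).map Complex.ofReal :=
      (map_pow (Complex.ofRealHom.mapMatrix) R k).symm
    rw [this, Matrix.map_apply, Complex.norm_real, Real.norm_eq_abs]
  -- The column `n % ℓ` varies with `n`, so the whole row serves as majorant.
  have hsum : Tendsto (fun k : ℕ => ∑ j, |(R ^ k) i j|) atTop (𝓝 0) := by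
    simpa using tendsto_finsetSum Finset.univ fun j _ => hpow j
  refine squeeze_zero_norm (fun n => ?_) (hsum.comp (Nat.tendsto_div_const_atTop hℓ.ne'))
  exact Finset.single_le_sum (f := fun j => |(R ^ (n / ℓ)) i j|) (fun j _ => abs_nonneg _)
    (Finset.mem_univ _)

/-- Vanishing jump probabilities pad the window of `2ℓ + 1` indices starting at `j` to all of `[0,
3ℓ)`, which splits into three blocks. -/
lemma sum_jumpProb_eq_block {ℓ : ℕ} (p : ℝ) (z : ℕ → ℝ) (j : Fin ℓ) :
    ∑ m ∈ Finset.range (2 * ℓ + 1), jumpProb ℓ p (ℓ - m) * z (j + m)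
      = ∑ i : Fin ℓ, z i * block ℓ p 1 i j + ∑ i : Fin ℓ, z (ℓ + i) * block ℓ p 0 i j
        + ∑ i : Fin ℓ, z (ℓ + ℓ + i) * block ℓ p (-1) i j := by
  have hj := j.2
  have h1 := Finset.sum_range_add
    (fun N : ℕ => jumpProb ℓ p (j + ℓ - N) * z N) j (2 * ℓ + 1)
  have h2 := Finset.sum_range_add
    (fun N : ℕ => jumpProb ℓ p (j + ℓ - N) * z N) (j + (2 * ℓ + 1)) (ℓ - j - 1)
  have h3 := Finset.sum_range_add
    (fun N : ℕ => jumpProb ℓ p (j + ℓ - N) * z N) (ℓ + ℓ) ℓ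
  have h4 := Finset.sum_range_add
    (fun N : ℕ => jumpProb ℓ p (j + ℓ - N) * z N) ℓ ℓ
  have z1 : ∑ N ∈ Finset.range j, jumpProb ℓ p (j + ℓ - N) * z N = 0 :=
    Finset.sum_eq_zero fun N hN => by
      rw [jumpProb_eq_zero p (by have := Finset.mem_range.1 hN; omega), zero_mul]
  have z2 : ∑ N ∈ Finset.range (ℓ - j - 1), jumpProb ℓ p (j + ℓ - (j + (2 * ℓ + 1) + N : ℕ))
      * z (j + (2 * ℓ + 1) + N) = 0 :=
    Finset.sum_eq_zero fun N hN => by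
      rw [jumpProb_eq_zero p (by omega), zero_mul]
  rw [z1, zero_add] at h1
  rw [z2, add_zero, show (j : ℕ) + (2 * ℓ + 1) + (ℓ - j - 1) = ℓ + ℓ + ℓ by omega, h3, h4, h1] at h2
  simp only [Finset.sum_range (n := ℓ)] at h2
  calc _ = ∑ m ∈ Finset.range (2 * ℓ + 1), jumpProb ℓ p (j + ℓ - (j + m : ℕ)) * z (j + m) :=
        Finset.sum_congr rfl fun m _ => by
          congr 2
          push_cast
          ring
    _ = _ := h2.symm
    _ = _ := by
        congr 1
        · congr 1
          all_goals
            refine Finset.sum_congr rfl fun i _ => ?_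
            rw [mul_comm, block, Matrix.of_apply]
            congr 2
            push_cast
            ring
        · refine Finset.sum_congr rfl fun i _ => ?_
          rw [mul_comm, block, Matrix.of_apply]
          congr 2
          push_cast
          ring

/-- At `n = kℓ + j` the recurrence is entry `(i, j)` of `R ^ k` times the quadratic matrix equation.
-/
lemma rowSeq_fullRec {ℓ : ℕ} {p : ℝ} {R : Matrix (Fin ℓ) (Fin ℓ) ℝ}
    (hR : R ^ 2 * block ℓ p (-1) + R * (block ℓ p 0 - 1) + block ℓ p 1 = 0) (i : Fin ℓ) :
    FullRec ℓ p (rowSeq R i) := by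
  intro n
  have hℓ := i.pos
  obtain ⟨k, j, rfl⟩ : ∃ (k : ℕ) (j : Fin ℓ), n = k * ℓ + j :=
    ⟨n / ℓ, ⟨n % ℓ, Nat.mod_lt _ hℓ⟩, (Nat.div_add_mod' n ℓ).symm⟩
  have h := sum_jumpProb_eq_block p (fun N => rowSeq R i (k * ℓ + N)) j
  have h1 : ∀ a : Fin ℓ, rowSeq R i (k * ℓ + (ℓ + a)) = (R ^ (k + 1)) i a := fun a => by
    rw [← rowSeq_add]
    congr 1
    ring
  have h2 : ∀ a : Fin ℓ, rowSeq R i (k * ℓ + (ℓ + ℓ + a)) = (R ^ (k + 2)) i a := fun a => by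
    rw [← rowSeq_add]
    congr 1
    ring
  simp only [← add_assoc] at h
  rw [h, show k * ℓ + j + ℓ = (k + 1) * ℓ + (j : ℕ) by ring, rowSeq_add]
  simp only [← add_assoc] at h1 h2
  simp only [h1, h2, rowSeq_add]
  simp only [← Matrix.mul_apply]
  have h3 : R ^ k * block ℓ p 1 + R ^ (k + 1) * block ℓ p 0 + R ^ (k + 2) * block ℓ p (-1)
      = R ^ (k + 1) := by
    have h4 : R ^ k * (R ^ 2 * block ℓ p (-1) + R * (block ℓ p 0 - 1) + block ℓ p 1) = 0 := by
      rw [hR, mul_zero]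
    rw [← sub_eq_zero, ← h4, pow_add, pow_add, pow_one]
    noncomm_ring
  exact congrFun (congrFun h3 i) j

lemma block_nonneg (ℓ : ℕ) {p : ℝ} (hp : 0 ≤ p) (hp1 : p ≤ 1) (k : ℤ) (i j : Fin ℓ) :
    0 ≤ block ℓ p k i j := jumpProb_nonneg ℓ hp hp1 _

lemma fullRec_geometric {ℓ : ℕ} {p t : ℝ} (ht : (p + (1 - p) * t) ^ 2 = t) :
    FullRec ℓ p (fun n => t ^ n) := by
  intro n
  have h : (t : ℝ) ^ ℓ
      = ∑ m ∈ Finset.range (2 * ℓ + 1), jumpProb ℓ p (ℓ - m) * t ^ m := by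
    nth_rewrite 1 [← ht]
    rw [← pow_mul, add_comm, add_pow]
    refine Finset.sum_congr rfl fun m hm => ?_
    rw [jumpProb_sub p (by simpa [Nat.lt_succ_iff] using hm), mul_pow]
    ring
  beta_reduce
  rw [pow_add, h, Finset.mul_sum]
  refine Finset.sum_congr rfl fun m _ => ?_
  ring

/-! ### Existence of the rate matrix -/

/-- The fixed-point iteration whose minimal nonnegative fixed point is the rate matrix. -/
def rateIter (ℓ : ℕ) (p : ℝ) : ℕ → Matrix (Fin ℓ) (Fin ℓ) ℝ
  | 0 => 0
  | n + 1 => block ℓ p 1 + rateIter ℓ p n * block ℓ p 0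
      + rateIter ℓ p n * rateIter ℓ p n * block ℓ p (-1)

section

variable {m : Type*} [Fintype m]

lemma mul_nonneg_entries {A B : Matrix m m ℝ} (hA : ∀ i j, 0 ≤ A i j) (hB : ∀ i j, 0 ≤ B i j)
    (i j : m) : 0 ≤ (A * B) i j := by
  rw [Matrix.mul_apply]
  exact Finset.sum_nonneg fun k _ => mul_nonneg (hA i k) (hB k j)

lemma mul_le_mul_entries {A B A' B' : Matrix m m ℝ} (hA : ∀ i j, A i j ≤ A' i j)
    (hB : ∀ i j, B i j ≤ B' i j) (hA' : ∀ i j, 0 ≤ A' i j) (hB0 : ∀ i j, 0 ≤ B i j)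
    (i j : m) : (A * B) i j ≤ (A' * B') i j := by
  rw [Matrix.mul_apply, Matrix.mul_apply]
  exact Finset.sum_le_sum fun k _ => mul_le_mul (hA i k) (hB k j) (hB0 k j) (hA' i k)

lemma vecMul_le_vecMul {A : Matrix m m ℝ} (hA : ∀ i j, 0 ≤ A i j) {v w : m → ℝ}
    (h : ∀ i, v i ≤ w i) (j : m) : Matrix.vecMul v A j ≤ Matrix.vecMul w A j :=
  Finset.sum_le_sum fun i _ => mul_le_mul_of_nonneg_right (h i) (hA i j)

/-- Eigenvalues of a nonnegative matrix with a positive left subinvariant vector. -/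
lemma norm_le_of_subinvariant [DecidableEq m] {R : Matrix m m ℝ} (hR : ∀ i j, 0 ≤ R i j)
    {u : m → ℝ} (hu : ∀ i, 0 < u i) {θ : ℝ} (h : ∀ j, Matrix.vecMul u R j ≤ θ * u j)
    {z : ℂ} (hz : z ∈ spectrum ℂ (R.map Complex.ofReal)) : ‖z‖ ≤ θ := by
  rw [spectrum.mem_iff, Matrix.isUnit_iff_isUnit_det, isUnit_iff_ne_zero, not_not,
    ← Matrix.exists_mulVec_eq_zero_iff] at hz
  obtain ⟨v, hv, hzv⟩ := hz
  have hev : ∀ i, z * v i = ∑ j, (R i j : ℂ) * v j := fun i => by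
    have := congrFun hzv i
    rw [Matrix.sub_mulVec, Pi.sub_apply, Pi.zero_apply, sub_eq_zero, Algebra.algebraMap_eq_smul_one,
      Matrix.smul_mulVec, Matrix.one_mulVec] at this
    exact this
  have hi : ∀ i, ‖z‖ * ‖v i‖ ≤ ∑ j, R i j * ‖v j‖ := fun i => by
    rw [← norm_mul, hev]
    refine (norm_sum_le _ _).trans (Finset.sum_le_sum fun j _ => ?_)
    rw [norm_mul, Complex.norm_real, Real.norm_of_nonneg (hR i j)]
  have hpos : 0 < ∑ i, u i * ‖v i‖ := by
    obtain ⟨i, hvi⟩ := Function.ne_iff.1 hv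
    exact Finset.sum_pos' (fun i _ => mul_nonneg (hu i).le (norm_nonneg _))
      ⟨i, Finset.mem_univ i, mul_pos (hu i) (norm_pos_iff.2 hvi)⟩
  refine le_of_mul_le_mul_right ?_ hpos
  calc ‖z‖ * ∑ i, u i * ‖v i‖ = ∑ i, u i * (‖z‖ * ‖v i‖) := by
        rw [Finset.mul_sum]
        exact Finset.sum_congr rfl fun i _ => by ring
    _ ≤ ∑ i, u i * ∑ j, R i j * ‖v j‖ :=
        Finset.sum_le_sum fun i _ => mul_le_mul_of_nonneg_left (hi i) (hu i).le
    _ = ∑ j, Matrix.vecMul u R j * ‖v j‖ := by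
        simp only [Finset.mul_sum, Matrix.vecMul, dotProduct, Finset.sum_mul]
        rw [Finset.sum_comm]
        exact Finset.sum_congr rfl fun i _ => Finset.sum_congr rfl fun j _ => by ring
    _ ≤ ∑ j, θ * u j * ‖v j‖ :=
        Finset.sum_le_sum fun j _ => mul_le_mul_of_nonneg_right (h j) (norm_nonneg _)
    _ = θ * ∑ j, u j * ‖v j‖ := by
        rw [Finset.mul_sum]
        exact Finset.sum_congr rfl fun i _ => by ring

end

lemma rateIter_nonneg (ℓ : ℕ) {p : ℝ} (hp : 0 ≤ p) (hp1 : p ≤ 1) (n : ℕ) (i j : Fin ℓ) :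
    0 ≤ rateIter ℓ p n i j := by
  induction n generalizing i j with
  | zero => simp [rateIter]
  | succ n ih =>
    exact add_nonneg (add_nonneg (block_nonneg ℓ hp hp1 1 i j)
      (mul_nonneg_entries ih (block_nonneg ℓ hp hp1 0) i j))
      (mul_nonneg_entries (mul_nonneg_entries ih ih) (block_nonneg ℓ hp hp1 (-1)) i j)

lemma rateIter_le_succ (ℓ : ℕ) {p : ℝ} (hp : 0 ≤ p) (hp1 : p ≤ 1) (n : ℕ) (i j : Fin ℓ) :
    rateIter ℓ p n i j ≤ rateIter ℓ p (n + 1) i j := by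
  induction n generalizing i j with
  | zero =>
    exact rateIter_nonneg ℓ hp hp1 1 i j
  | succ n ih =>
    have h0 := rateIter_nonneg ℓ hp hp1 n
    have h1 := rateIter_nonneg ℓ hp hp1 (n + 1)
    exact add_le_add (add_le_add le_rfl
      (mul_le_mul_entries ih (fun _ _ => le_rfl) h1 (block_nonneg ℓ hp hp1 0) i j))
      (mul_le_mul_entries (mul_le_mul_entries ih ih h1 h0) (fun _ _ => le_rfl)
        (mul_nonneg_entries h1 h1) (block_nonneg ℓ hp hp1 (-1)) i j)

/-- The geometric solution gives `u A₁ + t^ℓ u A₀ + t^(2ℓ) u A₋₁ = t^ℓ u`, so the iteration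
preserves the bound. It yields both convergence and a spectral bound for the limit. -/
lemma rateIter_subinvariant (ℓ : ℕ) {p t : ℝ} (hp : 0 ≤ p) (hp1 : p ≤ 1) (ht0 : 0 ≤ t)
    (ht : (p + (1 - p) * t) ^ 2 = t) (n : ℕ) (j : Fin ℓ) :
    Matrix.vecMul (fun i : Fin ℓ => t ^ (i : ℕ)) (rateIter ℓ p n) j ≤ t ^ ℓ * t ^ (j : ℕ) := by
  set u : Fin ℓ → ℝ := fun i => t ^ (i : ℕ) with hu
  induction n generalizing j with
  | zero =>
    simp only [rateIter, Matrix.vecMul_zero, Pi.zero_apply]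
    positivity
  | succ n ih =>
    have hR := rateIter_nonneg ℓ hp hp1 n
    have e1 : ∀ j, Matrix.vecMul u (rateIter ℓ p n) j ≤ (t ^ ℓ • u) j := ih
    have e2 : ∀ j, Matrix.vecMul (Matrix.vecMul u (rateIter ℓ p n)) (rateIter ℓ p n) j
        ≤ (t ^ (ℓ + ℓ) • u) j := fun j => by
      refine (vecMul_le_vecMul hR e1 j).trans ?_
      rw [Matrix.smul_vecMul, Pi.smul_apply, smul_eq_mul, Pi.smul_apply, smul_eq_mul, pow_add,
        mul_assoc]
      exact mul_le_mul_of_nonneg_left (ih j) (pow_nonneg ht0 ℓ)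
    have hg := sum_jumpProb_eq_block p (fun n => t ^ n) j
    rw [fullRec_geometric (ℓ := ℓ) ht j] at hg
    beta_reduce at hg
    calc Matrix.vecMul u (rateIter ℓ p (n + 1)) j
        = Matrix.vecMul u (block ℓ p 1) j
          + Matrix.vecMul (Matrix.vecMul u (rateIter ℓ p n)) (block ℓ p 0) j
          + Matrix.vecMul (Matrix.vecMul (Matrix.vecMul u (rateIter ℓ p n)) (rateIter ℓ p n))
            (block ℓ p (-1)) j := by
          simp only [rateIter, Matrix.vecMul_add, Matrix.vecMul_vecMul, Pi.add_apply]
      _ ≤ Matrix.vecMul u (block ℓ p 1) j + Matrix.vecMul (t ^ ℓ • u) (block ℓ p 0) j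
          + Matrix.vecMul (t ^ (ℓ + ℓ) • u) (block ℓ p (-1)) j :=
          add_le_add (add_le_add le_rfl (vecMul_le_vecMul (block_nonneg ℓ hp hp1 0) e1 j))
            (vecMul_le_vecMul (block_nonneg ℓ hp hp1 (-1)) e2 j)
      _ = t ^ ℓ * t ^ (j : ℕ) := by
          rw [← pow_add, add_comm ℓ (j : ℕ), hg]
          simp only [Matrix.vecMul, dotProduct, hu, Pi.smul_apply, smul_eq_mul, pow_add]

lemma exists_isRateMatrix (ℓ : ℕ) (hℓ : 0 < ℓ) {p : ℝ} (hp : 0 < p) (hp2 : p < 1 - p) :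
    ∃ R, IsRateMatrix ℓ p R := by
  have hp1 : p ≤ 1 := by linarith
  have hq : 0 < 1 - p := by linarith
  -- The root below 1 of `(p + qt)² = t`; the other root is 1.
  set t : ℝ := p ^ 2 / (1 - p) ^ 2 with htdef
  have ht0 : 0 < t := by positivity
  have ht1 : t < 1 := by
    rw [htdef, div_lt_one (by positivity)]
    nlinarith
  have ht : (p + (1 - p) * t) ^ 2 = t := by
    rw [htdef]
    field_simp
    ring
  have hsub := rateIter_subinvariant ℓ hp.le hp1 ht0.le ht
  have hbdd : ∀ i j, BddAbove (Set.range fun n => rateIter ℓ p n i j) := fun i j => by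
    refine ⟨t ^ ℓ * t ^ (j : ℕ) / t ^ (i : ℕ), ?_⟩
    rintro _ ⟨n, rfl⟩
    rw [le_div_iff₀ (by positivity), mul_comm]
    refine le_trans ?_ (hsub n j)
    exact Finset.single_le_sum (f := fun i : Fin ℓ => t ^ (i : ℕ) * rateIter ℓ p n i j)
      (fun i _ => mul_nonneg (by positivity) (rateIter_nonneg ℓ hp.le hp1 n i j))
      (Finset.mem_univ i)
  have hmono : ∀ i j, Monotone fun n => rateIter ℓ p n i j := fun i j =>
    monotone_nat_of_le_succ fun n => rateIter_le_succ ℓ hp.le hp1 n i j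
  set R : Matrix (Fin ℓ) (Fin ℓ) ℝ := fun i j => ⨆ n, rateIter ℓ p n i j with hRdef
  have hlim : Tendsto (rateIter ℓ p) atTop (𝓝 R) :=
    tendsto_pi_nhds.2 fun i => tendsto_pi_nhds.2 fun j =>
      tendsto_atTop_ciSup (hmono i j) (hbdd i j)
  have hnonneg : ∀ i j, 0 ≤ R i j := fun i j =>
    (rateIter_nonneg ℓ hp.le hp1 0 i j).trans (le_ciSup (hbdd i j) 0)
  have hfix : R = block ℓ p 1 + R * block ℓ p 0 + R * R * block ℓ p (-1) := by
    refine tendsto_nhds_unique ((tendsto_add_atTop_iff_nat 1).2 hlim) ?_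
    have hc : Continuous fun N : Matrix (Fin ℓ) (Fin ℓ) ℝ =>
        block ℓ p 1 + N * block ℓ p 0 + N * N * block ℓ p (-1) := by fun_prop
    exact (hc.tendsto R).comp hlim
  refine ⟨R, hnonneg, ?_, fun z hz => ?_⟩
  · rw [mul_sub, mul_one, pow_two]
    nth_rewrite 4 [hfix]
    abel
  · have hle : ‖z‖ ≤ t ^ ℓ := by
      refine norm_le_of_subinvariant hnonneg (u := fun i : Fin ℓ => t ^ (i : ℕ))
        (fun i => by positivity) (fun j => ?_) hz
      have hc : Continuous fun N : Matrix (Fin ℓ) (Fin ℓ) ℝ =>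
          Matrix.vecMul (fun i : Fin ℓ => t ^ (i : ℕ)) N j := by
        simp only [Matrix.vecMul, dotProduct]
        fun_prop
      exact le_of_tendsto ((hc.tendsto R).comp hlim) (Eventually.of_forall fun n => hsub n j)
    exact hle.trans_lt (pow_lt_one₀ ht0.le ht1 hℓ.ne')

/-! ### Uniqueness of the rate matrix -/

section

variable {ℓ : ℕ} {p : ℝ} {σ μ : Fin ℓ → ℂ} {R : Matrix (Fin ℓ) (Fin ℓ) ℝ}

lemma IsRateMatrix.reduced (hR : IsRateMatrix ℓ p R) (h : AreRootPairs ℓ p σ μ) (hp : 0 < p)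
    (hp2 : p < 1 - p) (i : Fin ℓ) :
    aeval shift (∏ j : Fin ℓ, (1 - C (μ j) * X)) (fun n => (rowSeq R i n : ℂ)) = 0 :=
  (rowSeq_fullRec hR.equation i).reduced (rowSeq_tendsto hR.spectrum_lt_one i) h hp hp2 i.pos

/-- Solutions of the recurrence of order `ℓ` are determined by their initial values. -/
lemma AreRootPairs.eq_of_initial (h : AreRootPairs ℓ p σ μ) (hp : 0 < p) (hp2 : p < 1 - p)
    {y z : ℕ → ℂ} (hy : aeval shift (∏ j : Fin ℓ, (1 - C (μ j) * X)) y = 0)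
    (hz : aeval shift (∏ j : Fin ℓ, (1 - C (μ j) * X)) z = 0) (h0 : ∀ k < ℓ, y k = z k) :
    y = z := by
  refine sub_eq_zero.1 (eq_zero_of_initial Finset.univ μ (fun j _ => h.ne_zero hp hp2 j)
    (by rw [map_sub, hy, hz, sub_zero]) fun k hk => ?_)
  rw [Pi.sub_apply, h0 k (by simpa using hk), sub_self]

lemma IsRateMatrix.unique {R' : Matrix (Fin ℓ) (Fin ℓ) ℝ} (hR : IsRateMatrix ℓ p R)
    (hR' : IsRateMatrix ℓ p R') (h : AreRootPairs ℓ p σ μ) (hp : 0 < p) (hp2 : p < 1 - p) :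
    R = R' := by
  ext i j
  have h1 := h.eq_of_initial hp hp2 (hR.reduced h hp hp2 i) (hR'.reduced h hp hp2 i)
    fun k hk => by rw [rowSeq_of_lt R i hk, rowSeq_of_lt R' i hk]
  have h2 := congrFun h1 (1 * ℓ + j)
  beta_reduce at h2
  rw [rowSeq_add, rowSeq_add, pow_one, pow_one] at h2
  exact_mod_cast h2

end

/-! ### Normalisation and the stationary vector -/

section

variable {ℓ : ℕ} {p : ℝ} {σ μ : Fin ℓ → ℂ} {R : Matrix (Fin ℓ) (Fin ℓ) ℝ}

lemma natDegree_prod_factor_le {ι : Type*} (s : Finset ι) (a : ι → ℂ) :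
    (∏ i ∈ s, (1 - C (a i) * X)).natDegree ≤ s.card := by
  refine (natDegree_prod_le s _).trans ?_
  rw [Finset.card_eq_sum_ones]
  refine Finset.sum_le_sum fun i _ => ?_
  refine (natDegree_sub_le _ _).trans (max_le (by simp) ?_)
  exact (natDegree_C_mul_le _ _).trans natDegree_X_le

lemma coeff_zero_prod_factor {ι : Type*} (s : Finset ι) (a : ι → ℂ) :
    (∏ i ∈ s, (1 - C (a i) * X)).coeff 0 = 1 := by
  rw [coeff_zero_eq_eval_zero, eval_prod]
  simp

/-- Summing a linear recurrence over a solution with initial values `1, 0, …, 0`. -/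
lemma eval_one_mul_tsum {f : ℂ[X]} (hℓ : 0 < ℓ) (hf : f.natDegree ≤ ℓ) {y : ℕ → ℂ}
    (hy : Summable y) (h0 : ∀ k < ℓ, y k = if k = 0 then 1 else 0) (h : aeval shift f y = 0) :
    f.eval 1 * ∑' n, y (n + ℓ) + f.coeff 0 = 0 := by
  -- Removing the first `k + 1 ≤ ℓ` terms always removes total 1. Only the unshifted sum differs,
  -- and this excess produces `f.coeff 0`.
  have htail : ∀ k < ℓ, ∑' n, y (n + (k + 1)) = ∑' n, y n - 1 := fun k hk => by
    have h1 := hy.sum_add_tsum_nat_add (k + 1)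
    rw [Finset.sum_range_succ', h0 0 hℓ, if_pos rfl, Finset.sum_eq_zero fun i hi => by
      rw [h0 (i + 1) (by have := Finset.mem_range.1 hi; omega), if_neg (by omega)], zero_add] at h1
    rw [← h1]
    ring
  have hT : ∑' n, y (n + ℓ) = ∑' n, y n - 1 := by
    have := htail (ℓ - 1) (by omega)
    rwa [Nat.sub_add_cancel hℓ] at this
  have hs : ∀ k, Summable fun n => y (n + k) := fun k => (summable_nat_add_iff k).2 hy
  have h1 : ∑' n, ∑ k ∈ Finset.range (ℓ + 1), f.coeff k * y (n + k) = 0 := by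
    rw [← tsum_zero (β := ℕ)]
    refine tsum_congr fun n => ?_
    rw [← aeval_shift_apply (Nat.lt_succ_of_le hf), h, Pi.zero_apply]
  rw [Summable.tsum_finsetSum fun k _ => (hs k).mul_left _] at h1
  simp only [tsum_mul_left] at h1
  rw [Finset.sum_range_succ'] at h1
  rw [Finset.sum_congr rfl fun k hk => by rw [htail k (Finset.mem_range.1 hk)],
    ← Finset.sum_mul] at h1
  rw [hT, eval_eq_sum_range' (Nat.lt_succ_of_le hf), Finset.sum_range_succ', ← h1]
  simp only [one_pow, mul_one, add_zero]
  ring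

lemma IsRateMatrix.summable_rowSeq (hR : IsRateMatrix ℓ p R) (h : AreRootPairs ℓ p σ μ)
    (hp : 0 < p) (hp2 : p < 1 - p) (i : Fin ℓ) : Summable (rowSeq R i) := by
  set M := (1 - p) ^ 2 / p ^ 2
  have hM : 1 < M := one_lt_ratio hp hp2
  have hM0 : 0 < M := by linarith
  -- The midpoint of `M⁻¹` and 1; any ratio strictly between them would do.
  have hτ0 : 0 < (1 + M⁻¹) / 2 := by positivity
  have hτ1 : (1 + M⁻¹) / 2 < 1 := by
    have := inv_lt_one_of_one_lt₀ hM
    linarith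
  obtain ⟨K, hK⟩ := exists_geometric_bound Finset.univ μ hτ0 (fun j _ => by
    have h1 : M * ((1 + M⁻¹) / 2) = (M + 1) / 2 := by field_simp
    have h2 := mul_le_mul_of_nonneg_right (h.le_norm hp hp2 j) hτ0.le
    change M * _ ≤ _ at h2
    linarith) (hR.reduced h hp hp2 i)
  refine Summable.of_norm_bounded ((summable_geometric_of_lt_one hτ0.le hτ1).mul_left K)
    fun n => ?_
  have := hK n
  rwa [Complex.norm_real] at this

lemma IsRateMatrix.rowSeq_nonneg (hR : IsRateMatrix ℓ p R) (i : Fin ℓ) (n : ℕ) :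
    0 ≤ rowSeq R i n := by
  have : ∀ k (a b : Fin ℓ), 0 ≤ (R ^ k) a b := fun k => by
    induction k with
    | zero =>
      intro a b
      rw [pow_zero, Matrix.one_apply]
      split_ifs <;> norm_num
    | succ k ih =>
      rw [pow_succ]
      exact mul_nonneg_entries ih hR.nonneg
  exact this _ _ _

lemma rowSeq_zero_lt (hℓ : 0 < ℓ) (R : Matrix (Fin ℓ) (Fin ℓ) ℝ) {k : ℕ} (hk : k < ℓ) :
    rowSeq R ⟨0, hℓ⟩ k = if k = 0 then 1 else 0 := by
  rw [rowSeq_of_lt R _ hk]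
  simp [eq_comm]

lemma IsRateMatrix.tsum_rowSeq (hR : IsRateMatrix ℓ p R) (h : AreRootPairs ℓ p σ μ)
    (hp : 0 < p) (hp2 : p < 1 - p) (hℓ : 0 < ℓ) :
    (-∏ j, (1 - μ j)) * ((∑' n, rowSeq R ⟨0, hℓ⟩ (n + ℓ) : ℝ) : ℂ) = 1 := by
  have h1 := eval_one_mul_tsum (f := ∏ j : Fin ℓ, (1 - C (μ j) * X)) hℓ
    (by simpa using natDegree_prod_factor_le Finset.univ μ)
    (Complex.ofRealCLM.summable (hR.summable_rowSeq h hp hp2 ⟨0, hℓ⟩))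
    (fun k hk => by
      rw [Complex.ofRealCLM_apply, rowSeq_zero_lt hℓ R hk]
      split_ifs <;> simp) (hR.reduced h hp hp2 ⟨0, hℓ⟩)
  rw [coeff_zero_prod_factor, eval_prod] at h1
  simp only [eval_sub, eval_one, eval_mul, eval_C, eval_X, mul_one, Complex.ofRealCLM_apply] at h1
  rw [Complex.ofReal_tsum]
  linear_combination -h1

lemma FullRec.succ {y : ℕ → ℝ} (hy : FullRec ℓ p y) : FullRec ℓ p (fun n => y (n + 1)) := by
  intro n
  have := hy (n + 1)
  beta_reduce
  rw [show n + ℓ + 1 = n + 1 + ℓ by ring, ← this]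
  refine Finset.sum_congr rfl fun m _ => ?_
  rw [show n + m + 1 = n + 1 + m by ring]

lemma FullRec.const_mul {y : ℕ → ℝ} (hy : FullRec ℓ p y) (a : ℝ) :
    FullRec ℓ p (fun n => a * y n) := by
  intro n
  beta_reduce
  rw [← hy n, Finset.mul_sum]
  refine Finset.sum_congr rfl fun m _ => ?_
  ring

/-- Row 0 has zeros at indices `1, …, ℓ - 1`. Its tail from `ℓ`, delayed by `ℓ`, therefore differs
from it only at index 0, which the equations for `j > 0` do not see. -/
lemma IsRateMatrix.isStationary (hR : IsRateMatrix ℓ p R) (h : AreRootPairs ℓ p σ μ)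
    (hp : 0 < p) (hp2 : p < 1 - p) (hℓ : 0 < ℓ) :
    IsStationary (cycleMatrix ℓ p) fun n =>
      (∑' n, rowSeq R ⟨0, hℓ⟩ (n + ℓ))⁻¹ * rowSeq R ⟨0, hℓ⟩ (n + ℓ) := by
  set x := rowSeq R ⟨0, hℓ⟩ with hx
  set T := ∑' n, x (n + ℓ) with hT
  have hp1 : p ≤ 1 := by linarith
  have hT0 : T ≠ 0 := fun h0 => by
    have := hR.tsum_rowSeq h hp hp2 hℓ
    rw [← hx, ← hT, h0] at this
    simp at this
  have hTpos : 0 ≤ T := tsum_nonneg fun n => hR.rowSeq_nonneg _ _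
  have hxs : Summable fun n => x (n + ℓ) :=
    (summable_nat_add_iff ℓ).2 (hR.summable_rowSeq h hp hp2 ⟨0, hℓ⟩)
  have hnonneg : ∀ n, 0 ≤ T⁻¹ * x (n + ℓ) := fun n =>
    mul_nonneg (inv_nonneg.2 hTpos) (hR.rowSeq_nonneg _ _)
  have hsum : HasSum (fun n => T⁻¹ * x (n + ℓ)) 1 := by
    have := hxs.hasSum.mul_left T⁻¹
    rwa [← hT, inv_mul_cancel₀ hT0] at this
  have hbal : ∀ j, 0 < j →
      HasSum (fun i => T⁻¹ * x (i + ℓ) * cycleMatrix ℓ p i j) (T⁻¹ * x (j + ℓ)) := by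
    refine (balance_iff hp.le hp1 (fun n => T⁻¹ * x (n + ℓ))).2 ?_
    convert ((rowSeq_fullRec hR.equation ⟨0, hℓ⟩).succ).const_mul T⁻¹ using 2 with n
    rw [delay]
    split_ifs with hn
    · rw [rowSeq_zero_lt hℓ R hn, if_neg (by omega), mul_zero]
    · rw [Nat.sub_add_cancel (by omega)]
  refine ⟨hnonneg, hsum, fun j => ?_⟩
  rcases Nat.eq_zero_or_pos j with rfl | hj
  · exact balance_zero (cycleMatrix_stochastic ℓ hp.le hp1) hnonneg hsum.summable hbal
  · exact hbal j hj

lemma aeval_shift_comp_succ (f : ℂ[X]) (y : ℕ → ℂ) (n : ℕ) :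
    aeval shift f (fun k => y (k + 1)) n = aeval shift f y (n + 1) := by
  rw [aeval_shift_apply (Nat.lt_succ_self _), aeval_shift_apply (Nat.lt_succ_self _)]
  refine Finset.sum_congr rfl fun k _ => ?_
  rw [show n + k + 1 = n + 1 + k by ring]

lemma IsStationary.eq_rowSeq {π : ℕ → ℝ} (hπ : IsStationary (cycleMatrix ℓ p) π)
    (hR : IsRateMatrix ℓ p R) (h : AreRootPairs ℓ p σ μ)
    (hp : 0 < p) (hp2 : p < 1 - p) (hℓ : 0 < ℓ) (n : ℕ) :
    π n = (∑' n, rowSeq R ⟨0, hℓ⟩ (n + ℓ))⁻¹ * rowSeq R ⟨0, hℓ⟩ (n + ℓ) := by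
  set x := rowSeq R ⟨0, hℓ⟩ with hx
  set T := ∑' n, x (n + ℓ) with hT
  have hp1 : p ≤ 1 := by linarith
  have hT0 : T ≠ 0 := fun h0 => by
    have := hR.tsum_rowSeq h hp hp2 hℓ
    rw [← hx, ← hT, h0] at this
    simp at this
  have hrec := (balance_iff hp.le hp1 π).1 fun j _ => hπ.invariant j
  have hlim : Tendsto (fun n => delay ℓ π (n + 1)) atTop (𝓝 0) := by
    refine (tendsto_add_atTop_iff_nat 1).2 ((tendsto_add_atTop_iff_nat ℓ).1 ?_)
    simpa only [delay_add] using hπ.hasSum_one.summable.tendsto_atTop_zero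
  have hw := hrec.reduced hlim h hp hp2 hℓ
  have hx' : aeval shift (∏ j : Fin ℓ, (1 - C (μ j) * X)) (fun n => (x (n + 1) : ℂ)) = 0 := by
    funext n
    rw [aeval_shift_comp_succ _ (fun n => (x n : ℂ)), hR.reduced h hp hp2 ⟨0, hℓ⟩]
    rfl
  -- Both sequences start with `ℓ - 1` zeros, so one value decides proportionality;
  -- cross-multiplying postpones `x ℓ ≠ 0`.
  have hinit : ∀ k < ℓ, x ℓ * delay ℓ π (k + 1) = π 0 * x (k + 1) := fun k hk => by
    rcases Nat.lt_or_ge (k + 1) ℓ with h1 | h1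
    · rw [delay, if_pos h1, hx, rowSeq_zero_lt hℓ R h1, if_neg (by omega), mul_zero, mul_zero]
    · obtain rfl : ℓ = k + 1 := by omega
      rw [delay, if_neg (by omega), Nat.sub_self, mul_comm]
  have hmul : ∀ n, x ℓ * π n = π 0 * x (n + ℓ) := fun n => by
    have h1 := h.eq_of_initial hp hp2 (y := (x ℓ : ℂ) • fun n => (delay ℓ π (n + 1) : ℂ))
      (z := (π 0 : ℂ) • fun n => (x (n + 1) : ℂ))
      (by rw [map_smul, hw, smul_zero]) (by rw [map_smul, hx', smul_zero]) fun k hk => by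
        simp only [Pi.smul_apply, smul_eq_mul]
        exact_mod_cast hinit k hk
    have h2 := congrFun h1 (n + (ℓ - 1))
    simp only [Pi.smul_apply, smul_eq_mul] at h2
    rw [show n + (ℓ - 1) + 1 = n + ℓ by omega, delay_add] at h2
    exact_mod_cast h2
  -- Otherwise `x` would vanish from index 1 on, contradicting `T ≠ 0`.
  have hxℓ : x ℓ ≠ 0 := fun h0 => by
    have h1 := h.eq_of_initial hp hp2 hx' (map_zero _) fun k hk => by
      rcases Nat.lt_or_ge (k + 1) ℓ with h1 | h1
      · rw [hx, rowSeq_zero_lt hℓ R h1]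
        simp
      · obtain rfl : ℓ = k + 1 := by omega
        simp [h0]
    refine hT0 ?_
    rw [hT, ← tsum_zero (β := ℕ)]
    refine tsum_congr fun n => ?_
    have h2 := congrFun h1 (n + (ℓ - 1))
    beta_reduce at h2
    rw [show n + (ℓ - 1) + 1 = n + ℓ by omega, Pi.zero_apply] at h2
    exact_mod_cast h2
  have hxT : x ℓ = π 0 * T := by
    have h1 := (hπ.hasSum_one.mul_left (x ℓ)).tsum_eq
    simp only [hmul, tsum_mul_left, mul_one] at h1
    exact h1.symm
  refine mul_left_cancel₀ hxℓ ?_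
  rw [hmul n]
  rw [hxT, mul_assoc, mul_inv_cancel_left₀ hT0]

lemma AreRootPairs.prod_erase_ne_zero (h : AreRootPairs ℓ p σ μ) (hp : 0 < p)
    (hp2 : p < 1 - p) (hℓ : 0 < ℓ) :
    ∏ ν ∈ Finset.univ.erase (⟨0, hℓ⟩ : Fin ℓ), (1 - μ ν * (μ ⟨0, hℓ⟩)⁻¹) ≠ 0 := by
  refine Finset.prod_ne_zero_iff.2 fun ν hν h0 => ?_
  have hμ0 := h.ne_zero hp hp2 ⟨0, hℓ⟩
  have h1 : μ ν = μ ⟨0, hℓ⟩ := by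
    field_simp at h0
    linear_combination -h0
  have h2 := h.lt_norm hp hp2 ν fun h0 => (Finset.mem_erase.1 hν).1 (Fin.ext h0)
  rw [h1, h.first_eq hp hp2 hℓ, Complex.norm_real, Real.norm_of_nonneg (by positivity)] at h2
  exact lt_irrefl _ h2

/-! ### Asymptotics -/

/-- The solution with initial values `1, 0, …, 0` is asymptotically a multiple of the powers of the
dominant characteristic root. -/
lemma IsRateMatrix.exists_rowSeq_bound (hR : IsRateMatrix ℓ p R) (h : AreRootPairs ℓ p σ μ)
    (hp : 0 < p) (hp2 : p < 1 - p) (hℓ : 0 < ℓ) :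
    ∃ τ K : ℝ, 0 < τ ∧ τ < p ^ 2 / (1 - p) ^ 2 ∧ ∀ n, ‖(rowSeq R ⟨0, hℓ⟩ n : ℂ)
      - (∏ ν ∈ Finset.univ.erase (⟨0, hℓ⟩ : Fin ℓ), (1 - μ ν * (μ ⟨0, hℓ⟩)⁻¹))⁻¹
        * (μ ⟨0, hℓ⟩)⁻¹ ^ n‖ ≤ K * τ ^ n := by
  set x : ℕ → ℂ := fun n => (rowSeq R ⟨0, hℓ⟩ n : ℂ) with hx
  set s := Finset.univ.erase (⟨0, hℓ⟩ : Fin ℓ) with hs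
  set μ₀ := μ ⟨0, hℓ⟩ with hμ₀
  set Q := ∏ ν ∈ s, (1 - C (μ ν) * X) with hQ
  have hscard : s.card = ℓ - 1 := by simp [hs]
  have hμ0 : μ₀ ≠ 0 := h.ne_zero hp hp2 _
  have hq : 0 < 1 - p := by linarith
  have hl : 0 < p ^ 2 / (1 - p) ^ 2 := by positivity
  have hlt : ∀ ν ∈ s, 1 < ‖μ ν‖ * (p ^ 2 / (1 - p) ^ 2) := fun ν hν => by
    have h1 := h.lt_norm hp hp2 ν fun h0 => (Finset.mem_erase.1 hν).1 (Fin.ext h0)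
    have h2 := mul_lt_mul_of_pos_right h1 hl
    rwa [div_mul_div_cancel₀ (by positivity), div_self (by positivity)] at h2
  have hne : Q.eval μ₀⁻¹ ≠ 0 := by
    rw [hQ, eval_prod]
    simpa using h.prod_erase_ne_zero hp hp2 hℓ
  obtain ⟨τ, hτ, hτ0, hτs⟩ : ∃ τ, τ < p ^ 2 / (1 - p) ^ 2 ∧ 0 < τ ∧ ∀ ν ∈ s, 1 < ‖μ ν‖ * τ := by
    have e1 : ∀ᶠ τ in 𝓝[<] (p ^ 2 / (1 - p) ^ 2), τ < p ^ 2 / (1 - p) ^ 2 :=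
      eventually_mem_nhdsWithin
    have e2 : ∀ᶠ τ in 𝓝[<] (p ^ 2 / (1 - p) ^ 2), 0 < τ :=
      nhdsWithin_le_nhds (eventually_gt_nhds hl)
    have e3 : ∀ᶠ τ in 𝓝[<] (p ^ 2 / (1 - p) ^ 2), ∀ ν ∈ s, 1 < ‖μ ν‖ * τ := by
      rw [Filter.eventually_all_finset]
      intro ν hν
      have hc : Continuous fun τ : ℝ => ‖μ ν‖ * τ := by fun_prop
      exact nhdsWithin_le_nhds ((hc.tendsto _).eventually_const_lt (hlt ν hν))
    exact (e1.and (e2.and e3)).exists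
  have hfull : aeval shift (1 - C μ₀ * X) (aeval shift Q x) = 0 := by
    have h1 := hR.reduced h hp hp2 ⟨0, hℓ⟩
    rwa [← Finset.mul_prod_erase _ _ (Finset.mem_univ (⟨0, hℓ⟩ : Fin ℓ)), map_mul,
      Module.End.mul_apply] at h1
  -- The remaining factor makes `Q(S) x` geometric. Its value at 0 is `Q.coeff 0 = 1`, because `Q`
  -- has degree below `ℓ` and `x` starts with `1, 0, …, 0`.
  have hQx : ∀ n, aeval shift Q x n = μ₀⁻¹ ^ n := fun n => by
    induction n with
    | zero =>
      rw [aeval_shift_apply (N := ℓ) (by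
        have := natDegree_prod_factor_le s μ
        rw [← hQ, hscard] at this
        omega), Finset.sum_eq_single_of_mem 0 (Finset.mem_range.2 hℓ) fun k hk hk0 => by
        rw [zero_add, hx]
        beta_reduce
        rw [rowSeq_zero_lt hℓ R (Finset.mem_range.1 hk), if_neg hk0, Complex.ofReal_zero, mul_zero],
        hQ, coeff_zero_prod_factor, hx]
      simp [rowSeq_zero_lt hℓ R hℓ]
    | succ n ih =>
      have h1 := congrFun hfull n
      rw [aeval_shift_factor, ih, Pi.zero_apply] at h1
      rw [pow_succ]
      field_simp
      field_simp at h1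
      linear_combination -h1
  -- `Q(S)` multiplies the geometric sequence by `Q(μ₀⁻¹)`, so this coefficient cancels `Q(S) x`
  -- exactly.
  have hr : aeval shift Q (x - (Q.eval μ₀⁻¹)⁻¹ • fun n => μ₀⁻¹ ^ n) = 0 := by
    funext n
    rw [map_sub, map_smul, Pi.sub_apply, Pi.smul_apply, hQx, aeval_shift_geometric, smul_eq_mul,
      inv_mul_cancel_left₀ hne, sub_self, Pi.zero_apply]
  obtain ⟨K, hK⟩ := exists_geometric_bound s μ hτ0 hτs hr
  refine ⟨τ, K, hτ0, hτ, fun n => ?_⟩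
  have h1 := hK n
  rw [hQ, eval_prod] at h1
  simpa using h1

lemma asymptotic_constant (hℓ : 0 < ℓ) (h0 : μ ⟨0, hℓ⟩ ≠ 0) :
    (-∏ ν, (1 - μ ν)) * ((∏ ν ∈ Finset.univ.erase (⟨0, hℓ⟩ : Fin ℓ),
        (1 - μ ν * (μ ⟨0, hℓ⟩)⁻¹))⁻¹ * (μ ⟨0, hℓ⟩)⁻¹ ^ ℓ)
      = (μ ⟨0, hℓ⟩ - 1) * (μ ⟨0, hℓ⟩)⁻¹ *
            ∏ ν ∈ Finset.univ.erase (⟨0, hℓ⟩ : Fin ℓ), (1 - μ ν) * (μ ⟨0, hℓ⟩ - μ ν)⁻¹ := by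
  set μ₀ := μ ⟨0, hℓ⟩
  set s := Finset.univ.erase (⟨0, hℓ⟩ : Fin ℓ) with hs
  have hscard : s.card = ℓ - 1 := by simp [hs]
  have h1 : ∏ ν ∈ s, (1 - μ ν * μ₀⁻¹) = (∏ ν ∈ s, (μ₀ - μ ν)) * μ₀⁻¹ ^ (ℓ - 1) := by
    rw [← hscard, ← Finset.prod_const, ← Finset.prod_mul_distrib]
    refine Finset.prod_congr rfl fun ν _ => ?_
    field_simp
  rw [h1, ← Finset.mul_prod_erase _ _ (Finset.mem_univ (⟨0, hℓ⟩ : Fin ℓ)), ← hs,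
    Finset.prod_mul_distrib, Finset.prod_inv_distrib, mul_inv,
    show μ₀⁻¹ ^ ℓ = μ₀⁻¹ ^ (ℓ - 1) * μ₀⁻¹ by rw [← pow_succ, Nat.sub_add_cancel hℓ]]
  have h2 : μ₀⁻¹ ^ (ℓ - 1) ≠ 0 := pow_ne_zero _ (inv_ne_zero h0)
  change -((1 - μ₀) * _) * _ = _
  field_simp
  ring

end

end TrafficLight

theorem theorem2 (ℓ : ℕ) (hℓ : 0 < ℓ) (p q : ℝ) (hp : 0 < p) (hq : q = 1 - p) (hpq : p < q)
    (σ μ : Fin ℓ → ℂ) (hμ : TrafficLight.AreRootPairs ℓ p σ μ) :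
    (∃! R : Matrix (Fin ℓ) (Fin ℓ) ℝ, TrafficLight.IsRateMatrix ℓ p R) ∧
    (∃! π : ℕ → ℝ, TrafficLight.IsStationary (TrafficLight.cycleMatrix ℓ p) π) ∧
    ∀ (R : Matrix (Fin ℓ) (Fin ℓ) ℝ) (π : ℕ → ℝ),
      TrafficLight.IsRateMatrix ℓ p R →
      TrafficLight.IsStationary (TrafficLight.cycleMatrix ℓ p) π →
      ((fun i : Fin ℓ => (π (i : ℕ) : ℂ)) =
        (-∏ ν : Fin ℓ, (1 - μ ν)) •
          Matrix.vecMul (Pi.single (⟨0, hℓ⟩ : Fin ℓ) (1 : ℂ)) (R.map Complex.ofReal)) ∧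
      Asymptotics.IsEquivalent Filter.atTop (fun n : ℕ => (π n : ℂ))
        (fun n : ℕ =>
          ((μ ⟨0, hℓ⟩ - 1) * (μ ⟨0, hℓ⟩)⁻¹ *
            ∏ ν ∈ Finset.univ.erase (⟨0, hℓ⟩ : Fin ℓ), (1 - μ ν) * (μ ⟨0, hℓ⟩ - μ ν)⁻¹) *
          ((p / q : ℝ) : ℂ) ^ (2 * n)) := by
  subst hq
  obtain ⟨R₀, hR₀⟩ := TrafficLight.exists_isRateMatrix ℓ hℓ hp hpq
  refine ⟨⟨R₀, hR₀, fun R' hR' => hR'.unique hR₀ hμ hp hpq⟩,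
    ⟨_, hR₀.isStationary hμ hp hpq hℓ,
      fun π hπ => funext fun n => hπ.eq_rowSeq hR₀ hμ hp hpq hℓ n⟩, fun R π hR hπ => ?_⟩
  set c : ℂ := -∏ ν : Fin ℓ, (1 - μ ν) with hc
  -- The constant `c` is the inverse of the total mass of the tail of row 0.
  have hπ' : ∀ n, (π n : ℂ) = c * TrafficLight.rowSeq R ⟨0, hℓ⟩ (n + ℓ) := fun n => by
    rw [hπ.eq_rowSeq hR hμ hp hpq hℓ n, Complex.ofReal_mul, Complex.ofReal_inv,
      hc, eq_inv_of_mul_eq_one_left (hR.tsum_rowSeq hμ hp hpq hℓ)]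
  refine ⟨funext fun i => ?_, ?_⟩
  · have h1 := TrafficLight.rowSeq_add R ⟨0, hℓ⟩ 1 i
    rw [one_mul, pow_one, add_comm] at h1
    rw [hπ', h1, Matrix.single_one_vecMul]
    rfl
  · obtain ⟨τ, K, hτ0, hτ, hK⟩ := hR.exists_rowSeq_bound hμ hp hpq hℓ
    have hμ0 := hμ.ne_zero hp hpq ⟨0, hℓ⟩
    rw [← TrafficLight.asymptotic_constant hℓ hμ0, ← hc]
    set A : ℂ := (∏ ν ∈ Finset.univ.erase (⟨0, hℓ⟩ : Fin ℓ), (1 - μ ν * (μ ⟨0, hℓ⟩)⁻¹))⁻¹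
      with hA
    have hpow : ∀ n : ℕ, ((p / (1 - p) : ℝ) : ℂ) ^ (2 * n) = (μ ⟨0, hℓ⟩)⁻¹ ^ n := fun n => by
      rw [pow_mul, hμ.first_eq hp hpq hℓ, ← Complex.ofReal_inv, inv_div, ← Complex.ofReal_pow,
        div_pow]
    have hD : c * (A * (μ ⟨0, hℓ⟩)⁻¹ ^ ℓ) ≠ 0 := by
      have hc0 : c ≠ 0 := left_ne_zero_of_mul_eq_one (hR.tsum_rowSeq hμ hp hpq hℓ)
      have hA0 : A ≠ 0 := inv_ne_zero (hμ.prod_erase_ne_zero hp hpq hℓ)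
      exact mul_ne_zero hc0 (mul_ne_zero hA0 (pow_ne_zero _ (inv_ne_zero hμ0)))
    simp only [hpow]
    refine Asymptotics.IsLittleO.isEquivalent ?_
    refine Asymptotics.IsLittleO.const_mul_right hD ?_
    -- The error is `O(τ^n)` with `τ < (p/q)² = μ₀⁻¹`, hence negligible since the leading
    -- coefficient is nonzero.
    have hO : (fun n : ℕ => (π n : ℂ) - c * (A * (μ ⟨0, hℓ⟩)⁻¹ ^ ℓ) * (μ ⟨0, hℓ⟩)⁻¹ ^ n)
        =O[Filter.atTop] fun n : ℕ => τ ^ n := by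
      refine Asymptotics.IsBigO.of_bound (‖c‖ * K * τ ^ ℓ) (Filter.Eventually.of_forall fun n => ?_)
      have h1 : (π n : ℂ) - c * (A * (μ ⟨0, hℓ⟩)⁻¹ ^ ℓ) * (μ ⟨0, hℓ⟩)⁻¹ ^ n
          = c * (TrafficLight.rowSeq R ⟨0, hℓ⟩ (n + ℓ) - A * (μ ⟨0, hℓ⟩)⁻¹ ^ (n + ℓ)) := by
        rw [hπ', pow_add]
        ring
      rw [h1, norm_mul, Real.norm_of_nonneg (by positivity)]
      calc ‖c‖ * _ ≤ ‖c‖ * (K * τ ^ (n + ℓ)) :=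
            mul_le_mul_of_nonneg_left (hK (n + ℓ)) (norm_nonneg c)
        _ = _ := by ring
    refine hO.trans_isLittleO ?_
    have hlt := isLittleO_pow_pow_of_lt_left hτ0.le hτ
    refine hlt.trans_le fun n => ?_
    rw [hμ.first_eq hp hpq hℓ, ← Complex.ofReal_inv, inv_div, ← Complex.ofReal_pow,
      Complex.norm_real]
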